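/- Let $(M^{2n+1},\xi=\ker\alpha)$ be a contact manifold and let $Y^{n+1}\subset M$ be a closed coisotropic submanifold such that $\lambda:=\alpha|_Y$ vanishes nowhere, so that $\mathcal F=\ker\lambda$ is a nonsingular codimension one (Legendrian) foliation on $Y$. Let $\Omega^\bullet(\mathcal F)=\Gamma(\wedge^\bullet T^*\mathcal F)$, with leafwise differential $d_{\mathcal F}$ given by Cartan's formula; choose $\mu\in\Omega^1(Y)$ with $d\lambda=\mu\wedge\lambda$, let $\pi(\mu)\in\Omega^1(\mathcal F)$ be its restriction to $\mathcal F$ (which depends only on $\lambda$), and put $d^\lambda_{\mathcal F}\omega=d_{\mathcal F}\omega-\pi(\mu)\wedge\omega$ and $H^1_{tw}(\mathcal F)=H^1(\Omega^\bullet(\mathcal F),d^\lambda_{\mathcal F})$. Fix a smooth line field $L$ on $Y$ transverse to $\mathcal F$; for $\zeta\in\Omega^1(\mathcal F)$ let $\overline\zeta\in\Omega^1(Y)$ be the one-form that equals $\zeta$ on $\mathcal F$ and vanishes on $L$. View $T^*\mathcal F$ as the annihilator of $L$ in $T^*Y$, equipped with the contact form $\pi^*\lambda-\eta$ (near the zero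 section), where $\eta$ is the restriction of the tautological one-form of $T^*Y$; it restricts to the one-form $\lambda-\overline s$ on the graph of a section $s$, and the graph is coisotropic if $(\lambda-\overline s)\wedge d(\lambda-\overline s)=0$. A form $\zeta\in\Omega^1(\mathcal F)$ is called an infinitesimal deformation of $(Y,\mathcal F)$ if it solves the linearization of this equation at $s=0$, i.e. if $(\lambda-t\overline\zeta)\wedge d(\lambda-t\overline\zeta)=o(t)$ as $t\to0$. An ambient isotopy is a smooth family of diffeomorphisms $\psi_t$ of $Y$ with $\psi_0=\mathrm{id}$. It carries $\zeta_0$ to $\zeta_1$ if there is a smooth family of nonvanishing functions $g_t$ on $Y$ with $g_0=1$ and $$\psi_t^*(\lambda-t\,\overline{\zeta_1})=g_t\,(\lambda-t\,\overline{\zeta_0})+o(t)\qquad (t\to 0).$$ Infinitesimal deformations $\zeta_0,\zeta_1$ are gauge equivalent if some ambient isotopy carries $\zeta_0$ to $\zeta_1$, and $\zeta$ is induced by $\psi_t$ if $\psi_t$ carries $0$ to $\zeta$ (that is, $\psi_t(\mathcal F)$ agrees with $\ker(\lambda-t\overline\zeta)$ to first order). Then: 1. $\zeta\in\Omega^1(\mathcal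 F)$ is an infinitesimal deformation if and only if $d^\lambda_{\mathcal F}\zeta=0$; moreover $d^\lambda_{\mathcal F}d^\lambda_{\mathcal F}f=0$ for all $f\in C^\infty(Y)$. 2. Every ambient isotopy induces exactly one $\zeta\in\Omega^1(\mathcal F)$, and the forms $\zeta$ induced by ambient isotopies are exactly the coboundaries $d^\lambda_{\mathcal F}f$, $f\in C^\infty(Y)$. 3. Gauge equivalence is an equivalence relation on the infinitesimal deformations, and $\zeta\mapsto[\zeta]$ induces a bijection from the set of infinitesimal deformations modulo gauge equivalence onto $H^1_{tw}(\mathcal F)$. -/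

import Mathlib

open scoped Manifold ContDiff Bundle Topology

noncomputable section

namespace LegendrianFoliation

/-! ### One-forms on manifolds -/

section Forms

variable {E : Type*} [NormedAddCommGroup E] [NormedSpace ℝ E]
  {M : Type*} [TopologicalSpace M] [ChartedSpace E M]
  {E' : Type*} [NormedAddCommGroup E'] [NormedSpace ℝ E']
  {N : Type*} [TopologicalSpace N] [ChartedSpace E' N]

/-- The cotangent space at `x`. -/
abbrev Cotangent (E : Type*) [NormedAddCommGroup E] [NormedSpace ℝ E]
    {M : Type*} [TopologicalSpace M] [ChartedSpace E M] (x : M) : Type _ :=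
  TangentSpace 𝓘(ℝ, E) x →L[ℝ] ℝ

/-- A (not necessarily smooth) field of covectors. -/
abbrev CovectorField (E : Type*) [NormedAddCommGroup E] [NormedSpace ℝ E]
    (M : Type*) [TopologicalSpace M] [ChartedSpace E M] : Type _ :=
  ∀ x : M, Cotangent E x

/-- Smoothness of a covector field near a point, as a section of the cotangent bundle. -/
def SmoothFormAt [IsManifold 𝓘(ℝ, E) ∞ M] (θ : CovectorField E M) (x : M) : Prop :=
  ContMDiffAt 𝓘(ℝ, E) (𝓘(ℝ, E).prod 𝓘(ℝ, E →L[ℝ] ℝ)) ∞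
    (fun y => Bundle.TotalSpace.mk' (E →L[ℝ] ℝ) (E := fun y : M => Cotangent E y) y (θ y)) x

/-- A smooth one-form on `M`. -/
def IsOneForm [IsManifold 𝓘(ℝ, E) ∞ M] (θ : CovectorField E M) : Prop :=
  ∀ x, SmoothFormAt θ x

/-- The pullback of a one-form by a map. -/
def pullbackForm (f : M → N) (θ : CovectorField E' N) : CovectorField E M :=
  fun x => (θ (f x)).comp (mfderiv 𝓘(ℝ, E) 𝓘(ℝ, E') f x)

/-- The differential of a function, as a covector field. -/
def diff (f : M → ℝ) : CovectorField E M := fun x => mfderiv 𝓘(ℝ, E) 𝓘(ℝ, ℝ) f x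

/-- The expression of a one-form in the preferred chart at `x`. -/
def chartForm (θ : CovectorField E M) (x : M) : E → E →L[ℝ] ℝ :=
  fun e => (θ ((extChartAt 𝓘(ℝ, E) x).symm e)).comp
    (mfderiv 𝓘(ℝ, E) 𝓘(ℝ, E) (extChartAt 𝓘(ℝ, E) x).symm e)

/-- The exterior derivative `dθ` of a one-form, evaluated at the point `x` on the tangent vectors
`u`, `v`. It is computed in the preferred chart at `x`, where `dθ (u, v) = D_u θ (v) - D_v θ (u)`. -/
def extD (θ : CovectorField E M) (x : M) (u v : TangentSpace 𝓘(ℝ, E) x) : ℝ :=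
  let φ := extChartAt 𝓘(ℝ, E) x
  let u' : E := mfderiv 𝓘(ℝ, E) 𝓘(ℝ, E) φ x u
  let v' : E := mfderiv 𝓘(ℝ, E) 𝓘(ℝ, E) φ x v
  fderiv ℝ (chartForm θ x) (φ x) u' v' - fderiv ℝ (chartForm θ x) (φ x) v' u'

/-- The three-form `θ ∧ dθ`, evaluated at `x` on three tangent vectors. -/
def wedgeExtD (θ : CovectorField E M) (x : M) (u v w : TangentSpace 𝓘(ℝ, E) x) : ℝ :=
  θ x u * extD θ x v w + θ x v * extD θ x w u + θ x w * extD θ x u v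

end Forms

/-! ### Contact forms, coisotropic submanifolds -/

section Contact

variable {E : Type*} [NormedAddCommGroup E] [NormedSpace ℝ E]
  {M : Type*} [TopologicalSpace M] [ChartedSpace E M]
  {E' : Type*} [NormedAddCommGroup E'] [NormedSpace ℝ E']
  {Y : Type*} [TopologicalSpace Y] [ChartedSpace E' Y]

/-- A contact form: a nowhere vanishing one-form `α` with `dα` nondegenerate on `ξ = ker α`. -/
structure IsContactForm [IsManifold 𝓘(ℝ, E) ∞ M] (α : CovectorField E M) : Prop where
  smooth : IsOneForm α
  ne_zero : ∀ x, α x ≠ 0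
  nondegenerate : ∀ (x : M) (u : TangentSpace 𝓘(ℝ, E) x), α x u = 0 →
    (∀ w : TangentSpace 𝓘(ℝ, E) x, α x w = 0 → extD α x u w = 0) → u = 0

/-- A smooth embedding (of finite-dimensional manifolds). -/
structure IsEmbeddedSubmanifold (j : Y → M) : Prop where
  smooth : ContMDiff 𝓘(ℝ, E') 𝓘(ℝ, E) ∞ j
  isEmbedding : Topology.IsEmbedding j
  injective_mfderiv : ∀ y, Function.Injective (mfderiv 𝓘(ℝ, E') 𝓘(ℝ, E) j y)

/-- The submanifold `j : Y → M` is coisotropic for `ξ = ker α`: at each point, the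
`dα`-orthogonal of `TY ∩ ξ` inside `ξ` is contained in `TY ∩ ξ`. -/
def IsCoisotropic (α : CovectorField E M) (j : Y → M) : Prop :=
  ∀ (y : Y) (u : TangentSpace 𝓘(ℝ, E) (j y)), α (j y) u = 0 →
    (∀ w : TangentSpace 𝓘(ℝ, E') y, α (j y) (mfderiv 𝓘(ℝ, E') 𝓘(ℝ, E) j y w) = 0 →
      extD α (j y) u (mfderiv 𝓘(ℝ, E') 𝓘(ℝ, E) j y w) = 0) →
    ∃ w : TangentSpace 𝓘(ℝ, E') y, mfderiv 𝓘(ℝ, E') 𝓘(ℝ, E) j y w = u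

end Contact

/-! ### The foliation `ker λ` and its twisted tangential cohomology in degree one -/

section Tangential

variable {E : Type*} [NormedAddCommGroup E] [NormedSpace ℝ E]
  {Y : Type*} [TopologicalSpace Y] [ChartedSpace E Y]

/-- The tangent space at `y` of the foliation `ker lam`. -/
abbrev leafTangent (lam : CovectorField E Y) (y : Y) : Submodule ℝ (TangentSpace 𝓘(ℝ, E) y) :=
  LinearMap.ker (lam y).toLinearMap

/-- The restriction of a covector field to the foliation. -/
def restrict (lam : CovectorField E Y) (θ : CovectorField E Y) (y : Y) :
    leafTangent lam y →L[ℝ] ℝ :=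
  (θ y).comp (leafTangent lam y).subtypeL

variable [IsManifold 𝓘(ℝ, E) ∞ Y]

/-- The space of tangential one-forms, i.e. of smooth sections of the leafwise cotangent bundle.
A section is smooth if near every point it is the restriction of a smooth one-form. -/
def tangentialForms (lam : CovectorField E Y) :
    Submodule ℝ (∀ y : Y, leafTangent lam y →L[ℝ] ℝ) where
  carrier := {ζ | ∀ y₀, ∃ σ : CovectorField E Y, SmoothFormAt σ y₀ ∧
    ∀ᶠ y in 𝓝 y₀, ζ y = restrict lam σ y}
  zero_mem' := fun y₀ => ⟨0, (ContMDiff.contMDiffAt (Bundle.contMDiff_zeroSection ℝ _)),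
    Filter.Eventually.of_forall fun y => rfl⟩
  add_mem' := by
    rintro a b ha hb y₀
    obtain ⟨σ, hσ, h⟩ := ha y₀
    obtain ⟨τ, hτ, h'⟩ := hb y₀
    refine ⟨σ + τ, ContMDiffAt.add_section hσ hτ, ?_⟩
    filter_upwards [h, h'] with y h1 h2
    rw [Pi.add_apply, h1, h2]
    rfl
  smul_mem' := by
    rintro c a ha y₀
    obtain ⟨σ, hσ, h⟩ := ha y₀
    refine ⟨c • σ, ContMDiffAt.const_smul_section hσ, ?_⟩
    filter_upwards [h] with y h1
    rw [Pi.smul_apply, h1]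
    rfl

/-- A tangential one-form. -/
def TangentialForm (lam : CovectorField E Y) : Type _ := tangentialForms lam

instance (lam : CovectorField E Y) : AddCommGroup (TangentialForm lam) :=
  inferInstanceAs (AddCommGroup (tangentialForms lam))

instance (lam : CovectorField E Y) : Module ℝ (TangentialForm lam) :=
  inferInstanceAs (Module ℝ (tangentialForms lam))

/-- Smooth vector fields on `Y` tangent to the foliation. -/
def TangentField (lam : CovectorField E Y) : Type _ :=
  {X : Cₛ^∞⟮𝓘(ℝ, E); E, fun y : Y => TangentSpace 𝓘(ℝ, E) y⟯ // ∀ y, lam y (X y) = 0}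

/-- The value of a family of leafwise covectors on a tangent vector (zero if the vector is
not tangent to the foliation, a case that does not occur below when the foliation is integrable). -/
def leafEval {lam : CovectorField E Y} (ζ : ∀ y : Y, leafTangent lam y →L[ℝ] ℝ) (y : Y)
    (w : TangentSpace 𝓘(ℝ, E) y) : ℝ :=
  open Classical in if h : w ∈ leafTangent lam y then ζ y ⟨w, h⟩ else 0

/-- The value of a tangential one-form on a vector field tangent to the foliation. -/
def evalField {lam : CovectorField E Y} (ζ : ∀ y : Y, leafTangent lam y →L[ℝ] ℝ)
    (X : TangentField lam) (y : Y) : ℝ := leafEval ζ y (X.1 y)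

/-- `κ` is the tangential one-form `π(μ)`, for a smooth one-form `μ` with `dλ = μ ∧ λ`. -/
def IsTwist (lam : CovectorField E Y) (κ : TangentialForm lam) : Prop :=
  ∃ μ : CovectorField E Y, IsOneForm μ ∧
    (∀ (y : Y) (u v : TangentSpace 𝓘(ℝ, E) y),
      extD lam y u v = μ y u * lam y v - μ y v * lam y u) ∧
    ∀ y, κ.1 y = restrict lam μ y

/-- The tangential one-form `π(μ)`, where `dλ = μ ∧ λ`. Such a `κ` exists and is unique when
`λ` is nowhere zero and `λ ∧ dλ = 0`. -/
def twist (lam : CovectorField E Y) : TangentialForm lam :=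
  open Classical in if h : ∃ κ, IsTwist lam κ then h.choose else 0

/-- The differential of a smooth function is a smooth one-form. -/
theorem smoothFormAt_diff (f : C^∞⟮𝓘(ℝ, E), Y; ℝ⟯) (y₀ : Y) :
    SmoothFormAt (diff f : CovectorField E Y) y₀ := by
  have h := ContMDiffAt.mfderiv_const (m := ∞) (f.contMDiff.contMDiffAt (x := y₀)) (by simp)
  refine (contMDiffAt_hom_bundle _).2 ⟨contMDiffAt_id, ?_⟩
  convert h using 1
  funext y
  simp only [inTangentCoordinates, ContinuousLinearMap.inCoordinates]
  ext v
  simp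
  rfl

/-- The twisted tangential differential `d_F^λ f = d_F f - f π(μ)` on functions. -/
def twistedD₀ (lam : CovectorField E Y) :
    C^∞⟮𝓘(ℝ, E), Y; ℝ⟯ →ₗ[ℝ] TangentialForm lam where
  toFun f := ⟨fun y => restrict lam (diff f) y - f y • (twist lam).1 y, by
    intro y₀
    obtain ⟨σ, hσ, h⟩ := (twist lam).2 y₀
    refine ⟨diff f - (⇑f • σ), ContMDiffAt.sub_section (smoothFormAt_diff f y₀)
        (ContMDiffAt.smul_section f.contMDiff.contMDiffAt hσ), ?_⟩
    filter_upwards [h] with y h1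
    rw [h1]
    rfl⟩
  map_add' f g := by
    refine Subtype.ext (funext fun y => ContinuousLinearMap.ext fun w => ?_)
    have h : diff (E := E) (⇑(f + g)) y w.1 = diff (E := E) f y w.1 + diff (E := E) g y w.1 :=
      congrArg (fun A : TangentSpace 𝓘(ℝ, E) y →L[ℝ] ℝ => A w.1)
        (mfderiv_add (f.contMDiff.mdifferentiable (by simp) y)
          (g.contMDiff.mdifferentiable (by simp) y))
    change diff (E := E) (⇑(f + g)) y w.1 - (f y + g y) * (twist lam).1 y w =
      (diff (E := E) f y w.1 - f y * (twist lam).1 y w) +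
        (diff (E := E) g y w.1 - g y * (twist lam).1 y w)
    rw [h]
    ring
  map_smul' c f := by
    refine Subtype.ext (funext fun y => ContinuousLinearMap.ext fun w => ?_)
    have h : diff (E := E) (⇑(c • f)) y w.1 = c * diff (E := E) f y w.1 :=
      congrArg (fun A : TangentSpace 𝓘(ℝ, E) y →L[ℝ] ℝ => A w.1)
        (const_smul_mfderiv (f.contMDiff.mdifferentiable (by simp) y) c)
    change diff (E := E) (⇑(c • f)) y w.1 - (c * f y) * (twist lam).1 y w =
      c * (diff (E := E) f y w.1 - f y * (twist lam).1 y w)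
    rw [h]
    ring

theorem leafEval_add {lam : CovectorField E Y} (ζ η : TangentialForm lam) (y : Y)
    (w : TangentSpace 𝓘(ℝ, E) y) :
    leafEval (ζ + η).1 y w = leafEval ζ.1 y w + leafEval η.1 y w := by
  unfold leafEval
  split_ifs
  · rfl
  · simp

theorem leafEval_smul {lam : CovectorField E Y} (c : ℝ) (ζ : TangentialForm lam) (y : Y)
    (w : TangentSpace 𝓘(ℝ, E) y) :
    leafEval (c • ζ).1 y w = c * leafEval ζ.1 y w := by
  unfold leafEval
  split_ifs
  · rfl
  · simp

theorem mdifferentiableAt_evalField {lam : CovectorField E Y} (ζ : TangentialForm lam)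
    (X : TangentField lam) (y₀ : Y) :
    MDifferentiableAt 𝓘(ℝ, E) 𝓘(ℝ, ℝ) (evalField ζ.1 X) y₀ := by
  obtain ⟨σ, hσ, h⟩ := ζ.2 y₀
  have h1 : (fun y => σ y (X.1 y)) =ᶠ[𝓝 y₀] evalField ζ.1 X := by
    filter_upwards [h] with y hy
    have hX : X.1 y ∈ leafTangent lam y := X.2 y
    simp only [evalField, leafEval, dif_pos hX, hy]
    rfl
  have h2 : ContMDiffAt 𝓘(ℝ, E) (𝓘(ℝ, E).prod 𝓘(ℝ, ℝ)) ∞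
      (fun y => Bundle.TotalSpace.mk' ℝ (E := Bundle.Trivial Y ℝ) y (σ y (X.1 y))) y₀ :=
    ContMDiffAt.clm_bundle_apply (F₁ := E) hσ X.1.contMDiff.contMDiffAt
  rw [Bundle.contMDiffAt_totalSpace] at h2
  exact (h2.2.mdifferentiableAt (by simp)).congr_of_eventuallyEq h1.symm

/-- The twisted tangential differential `d_F^λ ζ = d_F ζ - π(μ) ∧ ζ` on tangential one-forms.
The tangential two-form `d_F^λ ζ` is given through its values on pairs of vector fields tangent to
the foliation, where `d_F` is defined by Cartan's formula. -/
def twistedD₁ (lam : CovectorField E Y) :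
    TangentialForm lam →ₗ[ℝ] (TangentField lam → TangentField lam → Y → ℝ) where
  toFun ζ X Z y :=
    diff (evalField ζ.1 Z) y (X.1 y) - diff (evalField ζ.1 X) y (Z.1 y)
      - leafEval ζ.1 y (VectorField.mlieBracket 𝓘(ℝ, E) X.1 Z.1 y)
      - (evalField (twist lam).1 X y * evalField ζ.1 Z y
        - evalField (twist lam).1 Z y * evalField ζ.1 X y)
  map_add' ζ η := by
    funext X Z y
    have h : ∀ (X : TangentField lam) (w : TangentSpace 𝓘(ℝ, E) y),
        diff (evalField (ζ + η).1 X) y w =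
          diff (evalField ζ.1 X) y w + diff (evalField η.1 X) y w := fun X w => by
      have h' : evalField (ζ + η).1 X = evalField ζ.1 X + evalField η.1 X :=
        funext fun y => leafEval_add ζ η y _
      rw [h']
      exact congrArg (fun A : TangentSpace 𝓘(ℝ, E) y →L[ℝ] ℝ => A w)
        (mfderiv_add (mdifferentiableAt_evalField ζ X y) (mdifferentiableAt_evalField η X y))
    have h' : ∀ X : TangentField lam,
        evalField (ζ + η).1 X y = evalField ζ.1 X y + evalField η.1 X y :=
      fun X => leafEval_add ζ η y _
    simp only [Pi.add_apply, h, h', leafEval_add]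
    ring
  map_smul' c ζ := by
    funext X Z y
    have h : ∀ (X : TangentField lam) (w : TangentSpace 𝓘(ℝ, E) y),
        diff (evalField (c • ζ).1 X) y w = c * diff (evalField ζ.1 X) y w := fun X w => by
      have h' : evalField (c • ζ).1 X = c • evalField ζ.1 X :=
        funext fun y => leafEval_smul c ζ y _
      rw [h']
      exact congrArg (fun A : TangentSpace 𝓘(ℝ, E) y →L[ℝ] ℝ => A w)
        (const_smul_mfderiv (mdifferentiableAt_evalField ζ X y) c)
    have h' : ∀ X : TangentField lam, evalField (c • ζ).1 X y = c * evalField ζ.1 X y :=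
      fun X => leafEval_smul c ζ y _
    simp only [Pi.smul_apply, smul_eq_mul, RingHom.id_apply, h, h', leafEval_smul]
    ring

/-- Twisted tangential one-cocycles. -/
def twistedCocycles (lam : CovectorField E Y) : Submodule ℝ (TangentialForm lam) :=
  LinearMap.ker (twistedD₁ lam)

/-- Twisted tangential one-coboundaries. -/
def twistedCoboundaries (lam : CovectorField E Y) : Submodule ℝ (TangentialForm lam) :=
  LinearMap.range (twistedD₀ lam)

/-- The first twisted tangential cohomology `H¹_tw` of the foliation `ker lam`. -/
abbrev TwistedH1 (lam : CovectorField E Y) : Type _ :=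
  twistedCocycles lam ⧸ (twistedCoboundaries lam).comap (twistedCocycles lam).subtype

end Tangential

/-! ### Deformations -/

section Deformations

variable {E : Type*} [NormedAddCommGroup E] [NormedSpace ℝ E]
  {Y : Type*} [TopologicalSpace Y] [ChartedSpace E Y] [IsManifold 𝓘(ℝ, E) ∞ Y]

/-- A smooth line field `L` transverse to the foliation `ker lam`. -/
structure TransverseLineField (lam : CovectorField E Y) where
  line : ∀ y : Y, Submodule ℝ (TangentSpace 𝓘(ℝ, E) y)
  finrank_line : ∀ y, Module.finrank ℝ (line y) = 1
  isCompl : ∀ y, IsCompl (leafTangent lam y) (line y)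
  smooth : ∀ y₀ : Y, ∃ X : ∀ y : Y, TangentSpace 𝓘(ℝ, E) y,
    ContMDiffAt 𝓘(ℝ, E) 𝓘(ℝ, E).tangent ∞
      (fun y => (⟨y, X y⟩ : TangentBundle 𝓘(ℝ, E) Y)) y₀ ∧
    ∀ᶠ y in 𝓝 y₀, line y = Submodule.span ℝ {X y}

variable [FiniteDimensional ℝ E]

/-- The inclusion `i_L`: the one-form that agrees with `ζ` on the foliation and vanishes on `L`. -/
def extendByZero {lam : CovectorField E Y} (L : TransverseLineField lam)
    (ζ : TangentialForm lam) : CovectorField E Y := fun y =>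
  haveI : FiniteDimensional ℝ (TangentSpace 𝓘(ℝ, E) y) := inferInstanceAs (FiniteDimensional ℝ E)
  haveI : T2Space (TangentSpace 𝓘(ℝ, E) y) := inferInstanceAs (T2Space E)
  LinearMap.toContinuousLinearMap
    ((ζ.1 y).toLinearMap ∘ₗ (leafTangent lam y).projectionOnto (L.line y) (L.isCompl y))

/-- The total space of the cotangent bundle of `Y`. -/
abbrev CotangentBundle (E : Type*) [NormedAddCommGroup E] [NormedSpace ℝ E]
    (Y : Type*) [TopologicalSpace Y] [ChartedSpace E Y] : Type _ :=
  Bundle.TotalSpace (E →L[ℝ] ℝ) (fun y : Y => Cotangent E y)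

/-- The form `π^* λ - η` on the cotangent bundle of `Y`, `η` being the tautological one-form.
Its restriction to the annihilator of `L`, a subbundle which `i_L` identifies with the leafwise
cotangent bundle, is the contact form of the contact thickening. -/
def thickeningForm (lam : CovectorField E Y) :
    ∀ z : CotangentBundle E Y,
      TangentSpace (𝓘(ℝ, E).prod 𝓘(ℝ, E →L[ℝ] ℝ)) z →L[ℝ] ℝ := fun z =>
  (lam z.proj - z.snd).comp
    (mfderiv (𝓘(ℝ, E).prod 𝓘(ℝ, E →L[ℝ] ℝ)) 𝓘(ℝ, E) Bundle.TotalSpace.proj z)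

/-- A section of the leafwise cotangent bundle, viewed as a map into the annihilator of `L`. -/
def graphMap {lam : CovectorField E Y} (L : TransverseLineField lam) (s : TangentialForm lam)
    (y : Y) : CotangentBundle E Y := ⟨y, extendByZero L s y⟩

/-- The restriction of the contact form of the thickening to the graph of `s`, as a one-form
on `Y`. -/
def graphForm {lam : CovectorField E Y} (L : TransverseLineField lam) (s : TangentialForm lam) :
    CovectorField E Y := fun y =>
  (thickeningForm lam (graphMap L s y)).comp
    (mfderiv 𝓘(ℝ, E) (𝓘(ℝ, E).prod 𝓘(ℝ, E →L[ℝ] ℝ)) (graphMap L s) y)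

/-- The graph of `s` is coisotropic if `α ∧ dα` vanishes on it, `α` being the contact form
of the thickening. -/
def IsCoisotropicGraph {lam : CovectorField E Y} (L : TransverseLineField lam)
    (s : TangentialForm lam) : Prop :=
  ∀ y u v w, wedgeExtD (graphForm L s) y u v w = 0

/-- `ζ` is an infinitesimal deformation: it solves the linearization at the zero section of the
equation of `IsCoisotropicGraph`. -/
def IsInfinitesimalDeformation {lam : CovectorField E Y} (L : TransverseLineField lam)
    (ζ : TangentialForm lam) : Prop :=
  IsCoisotropicGraph L (0 : TangentialForm lam) ∧
  ∀ y u v w, HasDerivAt (fun t : ℝ => wedgeExtD (graphForm L (t • ζ)) y u v w) 0 0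

/-- An ambient isotopy of `Y`: a smooth family of diffeomorphisms starting at the identity. -/
structure AmbientIsotopy (E : Type*) [NormedAddCommGroup E] [NormedSpace ℝ E]
    (Y : Type*) [TopologicalSpace Y] [ChartedSpace E Y] where
  toDiffeo : ℝ → Diffeomorph 𝓘(ℝ, E) 𝓘(ℝ, E) Y Y ∞
  smooth : ContMDiff (𝓘(ℝ, ℝ).prod 𝓘(ℝ, E)) 𝓘(ℝ, E) ∞ (fun p : ℝ × Y => toDiffeo p.1 p.2)
  map_zero : ∀ y, toDiffeo 0 y = y

/-- The isotopy `ψ` carries the deformation `ker (λ - t ζ₀)` of `ker λ` to the deformation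
`ker (λ - t ζ₁)`, to first order in `t`: there is a smooth family of nonvanishing functions `g t`
with `g 0 = 1` and `(ψ t)^* (λ - t ζ₁) = g t (λ - t ζ₀) + o(t)`. -/
def CarriesToFirstOrder {lam : CovectorField E Y} (L : TransverseLineField lam)
    (ψ : AmbientIsotopy E Y) (ζ₀ ζ₁ : TangentialForm lam) : Prop :=
  ∃ g : ℝ → Y → ℝ,
    ContMDiff (𝓘(ℝ, ℝ).prod 𝓘(ℝ, E)) 𝓘(ℝ, ℝ) ∞ (fun p : ℝ × Y => g p.1 p.2) ∧
    (∀ t y, g t y ≠ 0) ∧ (∀ y, g 0 y = 1) ∧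
    ∀ (y : Y) (w : TangentSpace 𝓘(ℝ, E) y),
      HasDerivAt (fun t : ℝ =>
        pullbackForm (ψ.toDiffeo t) (lam - t • extendByZero L ζ₁) y w
          - g t y * (lam - t • extendByZero L ζ₀) y w) 0 0

/-- `ζ` is the infinitesimal deformation of `ker λ` induced by the isotopy `ψ`: the foliations
`ψ t (ker λ)` and `ker (λ - t ζ)` agree to first order. -/
def IsInducedBy {lam : CovectorField E Y} (L : TransverseLineField lam)
    (ψ : AmbientIsotopy E Y) (ζ : TangentialForm lam) : Prop :=
  CarriesToFirstOrder L ψ 0 ζ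

/-- Two infinitesimal deformations are gauge equivalent if some ambient isotopy carries one
to the other. -/
def GaugeEquivalent {lam : CovectorField E Y} (L : TransverseLineField lam)
    (ζ₀ ζ₁ : {ζ : TangentialForm lam // IsInfinitesimalDeformation L ζ}) : Prop :=
  ∃ ψ : AmbientIsotopy E Y, CarriesToFirstOrder L ψ ζ₀.1 ζ₁.1

end Deformations

end LegendrianFoliation

end

noncomputable section

namespace LegendrianFoliation

set_option linter.unusedSectionVars false

/-! ### Forms in charts and pullbacks -/

section Forms

variable {E : Type*} [NormedAddCommGroup E] [NormedSpace ℝ E]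
  {M : Type*} [TopologicalSpace M] [ChartedSpace E M]
  {E' : Type*} [NormedAddCommGroup E'] [NormedSpace ℝ E']
  {N : Type*} [TopologicalSpace N] [ChartedSpace E' N]
  {E'' : Type*} [NormedAddCommGroup E''] [NormedSpace ℝ E'']
  {P : Type*} [TopologicalSpace P] [ChartedSpace E'' P]

/-! Coisotropy and the dimensions make `TY ∩ ξ` Lagrangian in `ξ`: it has dimension `n` inside a
symplectic space of dimension `2n`, and it contains its orthogonal, which also has dimension `n`.
Hence `dλ` vanishes on `ker λ`. Let `R` span `L` with `λ(R) = 1`. Then `μ = dλ(·, R)` is a smooth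
form with `dλ = μ ∧ λ`, and a covector is determined by its restriction to the leaves together with
its value on `R`. Everything is checked on these two pieces.

Cocycles. With `σ` the extension of `ζ` by zero on `L`, the derivative of `(λ - tσ) ∧ d(λ - tσ)` at
`t = 0` is `-(σ ∧ dλ + λ ∧ dσ)`. On `(R, u, v)` with `u`, `v` leafwise this is `-(dσ - μ ∧ σ)(u,
v)`, and that component controls the whole three-form (`isInfinitesimalDeformation_iff`). For `ζ =
df - fμ` the leafwise expression reduces to `-f dμ`, which is zero on leaves because `d(dλ) = 0`
(`extD_twist_eq_zero`).

Isotopies. If `V` is the velocity of `ψ` at time zero, Cartan's magic formula gives the derivative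
of `ψ_t^* λ` as `d(λ(V)) + dλ(V, ·)`. On leaves `dλ(V, ·) = -λ(V) μ`, so with `f = λ(V)` the isotopy
changes `ζ₀` by exactly the twisted differential of `f`. The `R`-component is absorbed by the
conformal factor `g` (`carriesToFirstOrder_iff`).

Surjectivity. Every smooth `f` is some `λ(V)` (`exists_isotopy_apply_velocity_eq`). Only the
first-order behaviour matters, so no flow is needed: in a chart, `e ↦ e + β(t) W(e)` with small `β`
is a diffeomorphism with velocity `W`. Composition adds velocities, and on the compact `Y` a
partition of unity writes `f` as a finite sum of functions supported in charts. Gauge equivalence is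
therefore congruence modulo coboundaries, and the bijection with cohomology follows. -/

theorem pullbackForm_comp {g : N → P} {f : M → N} (θ : CovectorField E'' P) {x : M}
    (hg : MDifferentiableAt 𝓘(ℝ, E') 𝓘(ℝ, E'') g (f x))
    (hf : MDifferentiableAt 𝓘(ℝ, E) 𝓘(ℝ, E') f x) :
    (pullbackForm (g ∘ f) θ : CovectorField E M) x =
      pullbackForm f (pullbackForm g θ : CovectorField E' N) x := by
  unfold pullbackForm
  rw [mfderiv_comp x hg hf]
  rfl

theorem pullbackForm_congr {f g : M → N} (θ : CovectorField E' N) {x : M} (h : f =ᶠ[𝓝 x] g) :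
    (pullbackForm f θ : CovectorField E M) x = pullbackForm g θ x := by
  have h1 : (mfderiv 𝓘(ℝ, E) 𝓘(ℝ, E') f x : E →L[ℝ] E') = mfderiv 𝓘(ℝ, E) 𝓘(ℝ, E') g x :=
    h.mfderiv_eq
  let Θ : N → E' →L[ℝ] ℝ := θ
  change (Θ (f x)).comp (mfderiv 𝓘(ℝ, E) 𝓘(ℝ, E') f x : E →L[ℝ] E') =
    (Θ (g x)).comp (mfderiv 𝓘(ℝ, E) 𝓘(ℝ, E') g x : E →L[ℝ] E')
  rw [h1, h.eq_of_nhds]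

/-- The pullback of a one-form to a normed space. -/
def pullbackToModel (f : E' → M) (θ : CovectorField E M) : E' → E' →L[ℝ] ℝ :=
  fun z => (θ (f z)).comp (mfderiv 𝓘(ℝ, E') 𝓘(ℝ, E) f z)

/-- The exterior derivative of a one-form on a normed space. -/
def linD (A : E → E →L[ℝ] ℝ) (e u v : E) : ℝ := fderiv ℝ A e u v - fderiv ℝ A e v u

theorem linD_congr {A B : E → E →L[ℝ] ℝ} {e : E} (h : A =ᶠ[𝓝 e] B) (u v : E) :
    linD A e u v = linD B e u v := by
  unfold linD
  rw [h.fderiv_eq]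

/-- The derivative at `y` of the preferred chart at `x`. -/
def chartMap (x y : M) : TangentSpace 𝓘(ℝ, E) y →L[ℝ] E :=
  mfderiv 𝓘(ℝ, E) 𝓘(ℝ, E) (extChartAt 𝓘(ℝ, E) x) y

theorem extD_eq_linD (θ : CovectorField E M) (x : M) (u v : TangentSpace 𝓘(ℝ, E) x) :
    extD θ x u v = linD (chartForm θ x) (extChartAt 𝓘(ℝ, E) x x)
      (chartMap x x u) (chartMap x x v) := rfl

theorem extD_swap (θ : CovectorField E M) (x : M) (u v : TangentSpace 𝓘(ℝ, E) x) :
    extD θ x u v = - extD θ x v u := by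
  unfold extD
  simp

/-! ### Smooth forms in charts and naturality of `d`. -/

section Smooth

variable [IsManifold 𝓘(ℝ, E) ∞ M] [IsManifold 𝓘(ℝ, E') ∞ N]

theorem contMDiffAt_chart_symm {x : M} {e : E} (he : e ∈ (extChartAt 𝓘(ℝ, E) x).target) :
    ContMDiffAt 𝓘(ℝ, E) 𝓘(ℝ, E) ∞ (extChartAt 𝓘(ℝ, E) x).symm e :=
  (contMDiffOn_extChartAt_symm x).contMDiffAt ((isOpen_extChartAt_target x).mem_nhds he)

theorem contMDiffAt_chart {x y : M} (hy : y ∈ (extChartAt 𝓘(ℝ, E) x).source) :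
    ContMDiffAt 𝓘(ℝ, E) 𝓘(ℝ, E) ∞ (extChartAt 𝓘(ℝ, E) x) y :=
  contMDiffAt_extChartAt' (by simpa using hy)

/-- The evaluation of a smooth form on the image of a constant vector is smooth. -/
theorem SmoothFormAt.contMDiffAt_apply_mfderiv {θ : CovectorField E M} {f : E' → M} {U : Set E'}
    (hU : IsOpen U) (hf : ContMDiffOn 𝓘(ℝ, E') 𝓘(ℝ, E) ∞ f U) {e : E'} (he : e ∈ U)
    (h : SmoothFormAt θ (f e)) (v : E') :
    ContMDiffAt 𝓘(ℝ, E') 𝓘(ℝ, ℝ) ∞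
      (fun z => (pullbackForm f θ : CovectorField E' E') z v) e := by
  have hfe : ContMDiffAt 𝓘(ℝ, E') 𝓘(ℝ, E) ∞ f e := hf.contMDiffAt (hU.mem_nhds he)
  have h1 := h.comp e hfe
  have hv : ContMDiffAt 𝓘(ℝ, E') 𝓘(ℝ, E').tangent ∞
      (fun z : E' => (⟨z, v⟩ : TangentBundle 𝓘(ℝ, E') E')) e := by
    exact contMDiffAt_vectorSpace_iff_contDiffAt.2 contDiffAt_const
  have h2 := hf.contMDiffOn_tangentMapWithin (m := ∞) (by simp) hU.uniqueMDiffOn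
  have h3 := (h2.contMDiffAt (x := (⟨e, v⟩ : TangentBundle 𝓘(ℝ, E') E'))
    ((hU.preimage (FiberBundle.continuous_proj E' _)).mem_nhds he)).comp e hv
  have h4 : ContMDiffAt 𝓘(ℝ, E') (𝓘(ℝ, E).prod 𝓘(ℝ, E)) ∞ (fun z : E' =>
      Bundle.TotalSpace.mk' E (E := fun y : M => TangentSpace 𝓘(ℝ, E) y) (f z)
        (mfderiv 𝓘(ℝ, E') 𝓘(ℝ, E) f z v)) e := by
    refine h3.congr_of_eventuallyEq ?_
    filter_upwards [hU.mem_nhds he] with z hz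
    simp only [Function.comp, tangentMapWithin, mfderivWithin_of_isOpen hU hz]
  have h5 := ContMDiffAt.clm_bundle_apply (F₁ := E) (F₂ := ℝ)
    (E₂ := Bundle.Trivial M ℝ) (b := f) (ϕ := fun z => θ (f z)) h1 h4
  rw [Bundle.contMDiffAt_totalSpace] at h5
  exact h5.2

/-- A basis of the finite-dimensional `E` identifies `E →L[ℝ] E''` with a finite power of `E''`.
Smoothness of forms is thereby reduced to that of their values on constant vectors. -/
theorem contDiffAt_clm_apply [FiniteDimensional ℝ E] {A : E' → E →L[ℝ] E''} {e : E'}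
    {n : WithTop ℕ∞} (h : ∀ v, ContDiffAt ℝ n (fun z => A z v) e) : ContDiffAt ℝ n A e := by
  let d := Module.finrank ℝ E
  have hd : d = Module.finrank ℝ (Fin d → ℝ) := (Module.finrank_fin_fun ℝ).symm
  let e₁ := ContinuousLinearEquiv.ofFinrankEq hd
  let e₂ := (e₁.arrowCongr (1 : E'' ≃L[ℝ] E'')).trans (ContinuousLinearEquiv.piRing (Fin d))
  rw [← Function.id_comp A, ← e₂.symm_comp_self]
  exact e₂.symm.contDiff.contDiffAt.comp e (contDiffAt_pi.mpr fun i => h _)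

theorem SmoothFormAt.contDiffAt_pullbackForm [FiniteDimensional ℝ E']
    {θ : CovectorField E M} {f : E' → M} {U : Set E'}
    (hU : IsOpen U) (hf : ContMDiffOn 𝓘(ℝ, E') 𝓘(ℝ, E) ∞ f U) {e : E'} (he : e ∈ U)
    (h : SmoothFormAt θ (f e)) :
    ContDiffAt ℝ ∞ (pullbackToModel f θ) e := by
  refine contDiffAt_clm_apply fun v => (SmoothFormAt.contMDiffAt_apply_mfderiv hU hf he h v).contDiffAt

theorem SmoothFormAt.contDiffAt_chartForm [FiniteDimensional ℝ E] {θ : CovectorField E M}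
    {x : M} {e : E} (he : e ∈ (extChartAt 𝓘(ℝ, E) x).target)
    (h : SmoothFormAt θ ((extChartAt 𝓘(ℝ, E) x).symm e)) :
    ContDiffAt ℝ ∞ (chartForm θ x) e :=
  SmoothFormAt.contDiffAt_pullbackForm (isOpen_extChartAt_target x) (contMDiffOn_extChartAt_symm x) he h

theorem SmoothFormAt.contDiffAt_chartForm_self [FiniteDimensional ℝ E] {θ : CovectorField E M}
    {x : M} (h : SmoothFormAt θ x) :
    ContDiffAt ℝ ∞ (chartForm θ x) (extChartAt 𝓘(ℝ, E) x x) :=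
  SmoothFormAt.contDiffAt_chartForm (mem_extChartAt_target x) (by simpa using h)

/-- The trivialization of the cotangent bundle at `x` is induced by the preferred chart at `x`, so
the coordinates of `θ` in it are those of `chartForm θ x`. -/
theorem smoothFormAt_of_contDiffAt_chartForm {θ : CovectorField E M} {x : M}
    (h : ContDiffAt ℝ ∞ (chartForm θ x) (extChartAt 𝓘(ℝ, E) x x)) : SmoothFormAt θ x := by
  refine (contMDiffAt_hom_bundle _).2 ⟨contMDiffAt_id, ?_⟩
  refine (h.contMDiffAt.comp x (contMDiffAt_chart (mem_extChartAt_source x))).congr_of_eventuallyEq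
    ?_
  filter_upwards [extChartAt_source_mem_nhds (I := 𝓘(ℝ, E)) x] with y hy
  have hy' : y ∈ (chartAt E x).source := by simpa using hy
  have hyy := (extChartAt 𝓘(ℝ, E) x).left_inv hy
  rw [ContinuousLinearMap.inCoordinates, TangentBundle.symmL_trivializationAt hy']
  let Θ : M → E →L[ℝ] ℝ := θ
  have hΘ : Θ ((extChartAt 𝓘(ℝ, E) x).symm (extChartAt 𝓘(ℝ, E) x y)) = Θ y := by rw [hyy]
  refine Eq.trans ?_ (congrArg (fun A : E →L[ℝ] ℝ => A.comp
    (mfderiv 𝓘(ℝ, E) 𝓘(ℝ, E) (extChartAt 𝓘(ℝ, E) x).symm (extChartAt 𝓘(ℝ, E) x y))) hΘ.symm)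
  ext v
  simp [mfderivWithin_univ]
  rfl

/-- Differentiating the pullback also produces a term with the second derivative of `τ`. That term
is symmetric in `u`, `v`, so it cancels under antisymmetrization. -/
theorem linD_pullback {A : E → E →L[ℝ] ℝ} {τ : E' → E} {e : E'} (hτ : ContDiffAt ℝ 2 τ e)
    (hA : DifferentiableAt ℝ A (τ e)) (u v : E') :
    linD (fun z => (A (τ z)).comp (fderiv ℝ τ z)) e u v =
      linD A (τ e) (fderiv ℝ τ e u) (fderiv ℝ τ e v) := by
  have h1 : HasFDerivAt (fun z => A (τ z)) ((fderiv ℝ A (τ e)).comp (fderiv ℝ τ e)) e :=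
    hA.hasFDerivAt.comp e (hτ.differentiableAt (by norm_num)).hasFDerivAt
  have h2 : HasFDerivAt (fderiv ℝ τ) (fderiv ℝ (fderiv ℝ τ) e) e :=
    ((hτ.fderiv_right (m := 1) (by norm_num)).differentiableAt (by norm_num)).hasFDerivAt
  have h3 := hτ.isSymmSndFDerivAt (by simp)
  unfold linD
  rw [(h1.clm_comp h2).fderiv]
  simp [h3.eq u v]

/-- Both sides are pullbacks of `θ` along one map, factored either as `f` after the inverse chart at
`x`, or as the inverse chart at `f x` after the coordinate expression of `f`. -/
theorem chartForm_pullbackForm {f : N → M} {x : N}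
    (hf : ContMDiffAt 𝓘(ℝ, E') 𝓘(ℝ, E) ∞ f x) (θ : CovectorField E M) :
    chartForm (pullbackForm f θ : CovectorField E' N) x =ᶠ[𝓝 (extChartAt 𝓘(ℝ, E') x x)]
      fun e => (chartForm θ (f x) (writtenInExtChartAt 𝓘(ℝ, E') 𝓘(ℝ, E) x f e)).comp
        (fderiv ℝ (writtenInExtChartAt 𝓘(ℝ, E') 𝓘(ℝ, E) x f) e) := by
  have hev : ∀ᶠ y in 𝓝 x, MDifferentiableAt 𝓘(ℝ, E') 𝓘(ℝ, E) f y ∧ y ∈ (extChartAt 𝓘(ℝ, E') x).source ∧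
      f y ∈ (extChartAt 𝓘(ℝ, E) (f x)).source := by
    have h1 : ContMDiffAt 𝓘(ℝ, E') 𝓘(ℝ, E) 1 f x := hf.of_le (by simp)
    filter_upwards [(contMDiffAt_iff_contMDiffAt_nhds (by simp)).1 h1, extChartAt_source_mem_nhds (I := 𝓘(ℝ, E')) x,
      hf.continuousAt.preimage_mem_nhds (extChartAt_source_mem_nhds (I := 𝓘(ℝ, E)) (f x))]
      with y hy hy1 hy2
    exact ⟨ContMDiffAt.mdifferentiableAt hy (by simp), hy1, hy2⟩
  have hev2 : ∀ᶠ e in 𝓝 (extChartAt 𝓘(ℝ, E') x x), e ∈ (extChartAt 𝓘(ℝ, E') x).target ∧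
      MDifferentiableAt 𝓘(ℝ, E') 𝓘(ℝ, E) f ((extChartAt 𝓘(ℝ, E') x).symm e) ∧
      f ((extChartAt 𝓘(ℝ, E') x).symm e) ∈ (extChartAt 𝓘(ℝ, E) (f x)).source := by
    have := (continuousAt_extChartAt_symm (I := 𝓘(ℝ, E')) x).eventually
      (by rwa [extChartAt_to_inv (I := 𝓘(ℝ, E')) x])
    filter_upwards [this, extChartAt_target_mem_nhds (I := 𝓘(ℝ, E')) x] with e he he'
    exact ⟨he', he.1, he.2.2⟩
  -- The two factorizations must agree on a neighbourhood of `e`, not only at `e`, since their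
  -- derivatives are compared.
  filter_upwards [hev2.eventually_nhds] with e hee
  obtain ⟨he, hfe, hs⟩ := hee.self_of_nhds
  have hsymm : MDifferentiableAt 𝓘(ℝ, E') 𝓘(ℝ, E') (extChartAt 𝓘(ℝ, E') x).symm e :=
    (contMDiffAt_chart_symm he).mdifferentiableAt (by simp)
  have hw : MDifferentiableAt 𝓘(ℝ, E') 𝓘(ℝ, E) (writtenInExtChartAt 𝓘(ℝ, E') 𝓘(ℝ, E) x f) e :=
    ((contMDiffAt_chart hs).mdifferentiableAt (by simp)).comp e (hfe.comp e hsymm)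
  have ht : writtenInExtChartAt 𝓘(ℝ, E') 𝓘(ℝ, E) x f e ∈ (extChartAt 𝓘(ℝ, E) (f x)).target :=
    (extChartAt 𝓘(ℝ, E) (f x)).map_source hs
  have h1 : (pullbackForm (f ∘ (extChartAt 𝓘(ℝ, E') x).symm) θ : CovectorField E' E') e =
      (pullbackForm ((extChartAt 𝓘(ℝ, E) (f x)).symm ∘
        writtenInExtChartAt 𝓘(ℝ, E') 𝓘(ℝ, E) x f) θ : CovectorField E' E') e := by
    refine pullbackForm_congr θ ?_
    filter_upwards [hee] with z hz
    exact ((extChartAt 𝓘(ℝ, E) (f x)).left_inv hz.2.2).symm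
  rw [pullbackForm_comp θ hfe hsymm,
    pullbackForm_comp θ ((contMDiffAt_chart_symm ht).mdifferentiableAt (by simp)) hw] at h1
  refine Eq.trans h1 ?_
  rw [← mfderiv_eq_fderiv]
  rfl

theorem contDiffAt_writtenInExtChartAt {f : N → M} {x : N}
    (hf : ContMDiffAt 𝓘(ℝ, E') 𝓘(ℝ, E) ∞ f x) :
    ContDiffAt ℝ ∞ (writtenInExtChartAt 𝓘(ℝ, E') 𝓘(ℝ, E) x f) (extChartAt 𝓘(ℝ, E') x x) := by
  have := (contMDiffAt_iff.1 hf).2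
  simpa [contDiffWithinAt_univ] using this

theorem fderiv_writtenInExtChartAt {f : N → M} {x : N}
    (hf : ContMDiffAt 𝓘(ℝ, E') 𝓘(ℝ, E) ∞ f x) (u : TangentSpace 𝓘(ℝ, E') x) :
    fderiv ℝ (writtenInExtChartAt 𝓘(ℝ, E') 𝓘(ℝ, E) x f) (extChartAt 𝓘(ℝ, E') x x) (chartMap x x u) =
      chartMap (f x) (f x) (mfderiv 𝓘(ℝ, E') 𝓘(ℝ, E) f x u) := by
  have hd := ((contDiffAt_writtenInExtChartAt hf).differentiableAt (by simp)).mdifferentiableAt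
  have h1 := mfderiv_comp x hd
    ((contMDiffAt_chart (mem_extChartAt_source (I := 𝓘(ℝ, E')) x)).mdifferentiableAt (by simp))
  have h2 := mfderiv_comp x
    ((contMDiffAt_chart (mem_extChartAt_source (I := 𝓘(ℝ, E)) (f x))).mdifferentiableAt (by simp))
    (hf.mdifferentiableAt (by simp))
  have h3 : writtenInExtChartAt 𝓘(ℝ, E') 𝓘(ℝ, E) x f ∘ extChartAt 𝓘(ℝ, E') x =ᶠ[𝓝 x]
      extChartAt 𝓘(ℝ, E) (f x) ∘ f := by
    filter_upwards [extChartAt_source_mem_nhds (I := 𝓘(ℝ, E')) x] with y hy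
    simp only [writtenInExtChartAt, Function.comp, (extChartAt 𝓘(ℝ, E') x).left_inv hy]
  have h4 : (mfderiv 𝓘(ℝ, E') 𝓘(ℝ, E) (writtenInExtChartAt 𝓘(ℝ, E') 𝓘(ℝ, E) x f ∘
      extChartAt 𝓘(ℝ, E') x) x : E' →L[ℝ] E) = mfderiv 𝓘(ℝ, E') 𝓘(ℝ, E)
      (extChartAt 𝓘(ℝ, E) (f x) ∘ f) x := h3.mfderiv_eq
  have h5 := (h1.symm.trans h4).trans h2
  rw [mfderiv_eq_fderiv] at h5
  exact congrArg (fun A : E' →L[ℝ] E => A u) h5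

/-- Naturality of `d`. As `extD` uses a different preferred chart at each point, this is also what
makes it independent of the chart. -/
theorem extD_pullbackForm [FiniteDimensional ℝ E] {f : N → M} {x : N}
    (hf : ContMDiffAt 𝓘(ℝ, E') 𝓘(ℝ, E) ∞ f x) {θ : CovectorField E M} (hθ : SmoothFormAt θ (f x))
    (u v : TangentSpace 𝓘(ℝ, E') x) :
    extD (pullbackForm f θ : CovectorField E' N) x u v =
      extD θ (f x) (mfderiv 𝓘(ℝ, E') 𝓘(ℝ, E) f x u) (mfderiv 𝓘(ℝ, E') 𝓘(ℝ, E) f x v) := by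
  have hw : writtenInExtChartAt 𝓘(ℝ, E') 𝓘(ℝ, E) x f (extChartAt 𝓘(ℝ, E') x x) =
    extChartAt 𝓘(ℝ, E) (f x) (f x) := by simp [writtenInExtChartAt]
  have hA : DifferentiableAt ℝ (chartForm θ (f x))
      (writtenInExtChartAt 𝓘(ℝ, E') 𝓘(ℝ, E) x f (extChartAt 𝓘(ℝ, E') x x)) := by
    rw [hw]
    exact (SmoothFormAt.contDiffAt_chartForm_self hθ).differentiableAt (by simp)
  rw [extD_eq_linD, extD_eq_linD, linD_congr (chartForm_pullbackForm hf θ),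
    linD_pullback ((contDiffAt_writtenInExtChartAt hf).of_le (by norm_cast)) hA,
    fderiv_writtenInExtChartAt hf, fderiv_writtenInExtChartAt hf, hw]

theorem SmoothFormAt.pullbackForm [FiniteDimensional ℝ E] {f : N → M} {x : N}
    (hf : ContMDiffAt 𝓘(ℝ, E') 𝓘(ℝ, E) ∞ f x) {θ : CovectorField E M} (hθ : SmoothFormAt θ (f x)) :
    SmoothFormAt (pullbackForm f θ : CovectorField E' N) x := by
  refine smoothFormAt_of_contDiffAt_chartForm ?_
  refine ContDiffAt.congr_of_eventuallyEq ?_ (chartForm_pullbackForm hf θ)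
  have hw := contDiffAt_writtenInExtChartAt hf
  refine ContDiffAt.clm_comp (ContDiffAt.fun_comp _ ?_ hw) (hw.fderiv_right (m := ∞) (by exact_mod_cast le_rfl))
  have hw : writtenInExtChartAt 𝓘(ℝ, E') 𝓘(ℝ, E) x f (extChartAt 𝓘(ℝ, E') x x) =
    extChartAt 𝓘(ℝ, E) (f x) (f x) := by simp [writtenInExtChartAt]
  rw [hw]
  exact SmoothFormAt.contDiffAt_chartForm_self hθ

end Smooth
end Forms

/-! ### Vector fields in charts and Cartan's formula -/

section Charts

variable {E : Type*} [NormedAddCommGroup E] [NormedSpace ℝ E]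
  {M : Type*} [TopologicalSpace M] [ChartedSpace E M] [IsManifold 𝓘(ℝ, E) ∞ M]

/-- The derivative of the inverse of the preferred chart at `x`. -/
def chartInv (x : M) (e : E) : E →L[ℝ] TangentSpace 𝓘(ℝ, E) ((extChartAt 𝓘(ℝ, E) x).symm e) :=
  mfderiv 𝓘(ℝ, E) 𝓘(ℝ, E) (extChartAt 𝓘(ℝ, E) x).symm e

theorem chartMap_chartInv {x : M} {e : E} (he : e ∈ (extChartAt 𝓘(ℝ, E) x).target) (u : E) :
    chartMap x ((extChartAt 𝓘(ℝ, E) x).symm e) (chartInv x e u) = u := by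
  have h := mfderiv_extChartAt_comp_mfderivWithin_extChartAt_symm he
  simp only [modelWithCornersSelf_coe, Set.range_id, mfderivWithin_univ] at h
  exact congrArg (fun A : E →L[ℝ] E => A u) h

theorem chartInv_chartMap {x : M} {e : E} (he : e ∈ (extChartAt 𝓘(ℝ, E) x).target)
    (u : TangentSpace 𝓘(ℝ, E) ((extChartAt 𝓘(ℝ, E) x).symm e)) :
    chartInv x e (chartMap x ((extChartAt 𝓘(ℝ, E) x).symm e) u) = u := by
  have h := mfderivWithin_extChartAt_symm_comp_mfderiv_extChartAt he
  simp only [modelWithCornersSelf_coe, Set.range_id, mfderivWithin_univ] at h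
  exact congrArg (fun A : E →L[ℝ] E => A u) h

theorem chartForm_eq (θ : CovectorField E M) (x : M) (e u : E) :
    chartForm θ x e u = θ ((extChartAt 𝓘(ℝ, E) x).symm e) (chartInv x e u) := rfl

theorem chartForm_apply_symm (θ : CovectorField E M) {x : M} {e : E}
    (he : e ∈ (extChartAt 𝓘(ℝ, E) x).target)
    (u : TangentSpace 𝓘(ℝ, E) ((extChartAt 𝓘(ℝ, E) x).symm e)) :
    chartForm θ x e (chartMap x _ u) = θ ((extChartAt 𝓘(ℝ, E) x).symm e) u := by
  rw [chartForm_eq, chartInv_chartMap he]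

theorem chartForm_apply (θ : CovectorField E M) {x y : M}
    (hy : y ∈ (extChartAt 𝓘(ℝ, E) x).source) (u : TangentSpace 𝓘(ℝ, E) y) :
    chartForm θ x (extChartAt 𝓘(ℝ, E) x y) (chartMap x y u) = θ y u := by
  obtain ⟨e, he, rfl⟩ : ∃ e ∈ (extChartAt 𝓘(ℝ, E) x).target, (extChartAt 𝓘(ℝ, E) x).symm e = y :=
    ⟨_, (extChartAt 𝓘(ℝ, E) x).map_source hy, (extChartAt 𝓘(ℝ, E) x).left_inv hy⟩
  rw [(extChartAt 𝓘(ℝ, E) x).right_inv he, chartForm_apply_symm θ he]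

theorem chartForm_apply_self (θ : CovectorField E M) (x : M) (u : TangentSpace 𝓘(ℝ, E) x) :
    chartForm θ x (extChartAt 𝓘(ℝ, E) x x) (chartMap x x u) = θ x u :=
  chartForm_apply θ (mem_extChartAt_source (I := 𝓘(ℝ, E)) x) u

theorem chartForm_model (A : CovectorField E E) (x : E) :
    chartForm A x = A := by
  funext e
  unfold chartForm
  rw [extChartAt_model_space_eq_id, PartialEquiv.refl_symm]
  change (A e).comp (mfderiv 𝓘(ℝ, E) 𝓘(ℝ, E) id e) = A e
  rw [mfderiv_id]
  rfl

theorem chartMap_model (x y u : E) : chartMap x y u = u := by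
  unfold chartMap
  rw [extChartAt_model_space_eq_id]
  change mfderiv 𝓘(ℝ, E) 𝓘(ℝ, E) id y u = u
  rw [mfderiv_id]
  rfl

theorem extD_model (A : CovectorField E E) (e : E) (u v : TangentSpace 𝓘(ℝ, E) e) :
    extD A e u v = linD A e u v := by
  rw [extD_eq_linD, chartForm_model]
  exact congrArg₂ (linD A e) (chartMap_model e e u) (chartMap_model e e v)

/-- The exterior derivative may be computed in any preferred chart. -/
theorem extD_chartInv [FiniteDimensional ℝ E] {θ : CovectorField E M} {x : M} {e : E}
    (he : e ∈ (extChartAt 𝓘(ℝ, E) x).target)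
    (hθ : SmoothFormAt θ ((extChartAt 𝓘(ℝ, E) x).symm e)) (u v : E) :
    extD θ ((extChartAt 𝓘(ℝ, E) x).symm e) (chartInv x e u) (chartInv x e v) =
      linD (chartForm θ x) e u v := by
  refine (extD_pullbackForm (contMDiffAt_chart_symm he) hθ u v).symm.trans ?_
  exact extD_model _ e u v

theorem extD_eq_linD_symm [FiniteDimensional ℝ E] {θ : CovectorField E M} {x : M} {e : E}
    (he : e ∈ (extChartAt 𝓘(ℝ, E) x).target)
    (hθ : SmoothFormAt θ ((extChartAt 𝓘(ℝ, E) x).symm e))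
    (u v : TangentSpace 𝓘(ℝ, E) ((extChartAt 𝓘(ℝ, E) x).symm e)) :
    extD θ ((extChartAt 𝓘(ℝ, E) x).symm e) u v =
      linD (chartForm θ x) e (chartMap x _ u) (chartMap x _ v) := by
  rw [← extD_chartInv he hθ, chartInv_chartMap he, chartInv_chartMap he]

/-- A vector field in the preferred chart at `x`. -/
def chartField (V : ∀ y : M, TangentSpace 𝓘(ℝ, E) y) (x : M) : E → E :=
  fun e => chartMap x ((extChartAt 𝓘(ℝ, E) x).symm e) (V ((extChartAt 𝓘(ℝ, E) x).symm e))

/-- Smoothness of a vector field near a point. -/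
def SmoothFieldAt (V : ∀ y : M, TangentSpace 𝓘(ℝ, E) y) (x : M) : Prop :=
  ContMDiffAt 𝓘(ℝ, E) 𝓘(ℝ, E).tangent ∞ (fun y => (⟨y, V y⟩ : TangentBundle 𝓘(ℝ, E) M)) x

theorem SmoothFieldAt.contDiffAt_chartField {V : ∀ y : M, TangentSpace 𝓘(ℝ, E) y} {x : M}
    (h : SmoothFieldAt V x) : ContDiffAt ℝ ∞ (chartField V x) (extChartAt 𝓘(ℝ, E) x x) := by
  have h1 := (Bundle.contMDiffAt_section x).1 h
  have h2 : ContMDiffAt 𝓘(ℝ, E) 𝓘(ℝ, E) ∞ (fun y => chartMap x y (V y)) x := by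
    refine h1.congr_of_eventuallyEq ?_
    filter_upwards [extChartAt_source_mem_nhds (I := 𝓘(ℝ, E)) x] with y hy
    have hy' : y ∈ (chartAt E x).source := by simpa using hy
    have h3 := TangentBundle.continuousLinearMapAt_trivializationAt (I := 𝓘(ℝ, E)) hy'
    refine (congrArg (fun A : E →L[ℝ] E => A (V y)) h3).symm.trans ?_
    refine (congrFun ((trivializationAt E (TangentSpace 𝓘(ℝ, E)) x).continuousLinearMapAt_apply ℝ
      y) (V y)).trans ?_
    rw [Bundle.Trivialization.linearMapAt_apply, if_pos]
    simpa using hy'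
  have h4 := contMDiffAt_chart_symm (mem_extChartAt_target (I := 𝓘(ℝ, E)) x)
  refine (ContMDiffAt.comp _ (g := fun y => chartMap x y (V y)) ?_ h4).contDiffAt
  rwa [extChartAt_to_inv (I := 𝓘(ℝ, E)) x]

theorem SmoothFormAt.contMDiffAt_apply {θ : CovectorField E M}
    {V : ∀ y : M, TangentSpace 𝓘(ℝ, E) y} {x : M} (hθ : SmoothFormAt θ x) (h : SmoothFieldAt V x) :
    ContMDiffAt 𝓘(ℝ, E) 𝓘(ℝ, ℝ) ∞ (fun y => θ y (V y)) x := by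
  have h2 : ContMDiffAt 𝓘(ℝ, E) (𝓘(ℝ, E).prod 𝓘(ℝ, ℝ)) ∞
      (fun y => Bundle.TotalSpace.mk' ℝ (E := Bundle.Trivial M ℝ) y (θ y (V y))) x :=
    ContMDiffAt.clm_bundle_apply (F₁ := E) hθ h
  rw [Bundle.contMDiffAt_totalSpace] at h2
  exact h2.2

theorem chartForm_chartField (θ : CovectorField E M) (V : ∀ y : M, TangentSpace 𝓘(ℝ, E) y) {x : M}
    {e : E} (he : e ∈ (extChartAt 𝓘(ℝ, E) x).target) :
    chartForm θ x e (chartField V x e) =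
      θ ((extChartAt 𝓘(ℝ, E) x).symm e) (V ((extChartAt 𝓘(ℝ, E) x).symm e)) :=
  chartForm_apply_symm θ he _

theorem chartField_self (V : ∀ y : M, TangentSpace 𝓘(ℝ, E) y) (x : M) :
    chartField V x (extChartAt 𝓘(ℝ, E) x x) = chartMap x x (V x) := by
  unfold chartField
  rw [extChartAt_to_inv (I := 𝓘(ℝ, E)) x]

theorem diff_chartInv {f : M → ℝ} {x : M} {e : E} (he : e ∈ (extChartAt 𝓘(ℝ, E) x).target)
    (hf : MDifferentiableAt 𝓘(ℝ, E) 𝓘(ℝ, ℝ) f ((extChartAt 𝓘(ℝ, E) x).symm e)) (u : E) :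
    diff f _ (chartInv x e u) = fderiv ℝ (f ∘ (extChartAt 𝓘(ℝ, E) x).symm) e u := by
  rw [← mfderiv_eq_fderiv,
    mfderiv_comp e hf ((contMDiffAt_chart_symm he).mdifferentiableAt (by simp))]
  rfl

theorem diff_eq_fderiv {f : M → ℝ} {x : M} {g : E → ℝ}
    (hf : MDifferentiableAt 𝓘(ℝ, E) 𝓘(ℝ, ℝ) f x)
    (h : f ∘ (extChartAt 𝓘(ℝ, E) x).symm =ᶠ[𝓝 (extChartAt 𝓘(ℝ, E) x x)] g)
    (u : TangentSpace 𝓘(ℝ, E) x) :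
    diff f x u = fderiv ℝ g (extChartAt 𝓘(ℝ, E) x x) (chartMap x x u) := by
  rw [← h.fderiv_eq, ← diff_chartInv (mem_extChartAt_target x)
    (by rwa [extChartAt_to_inv (I := 𝓘(ℝ, E)) x])]
  exact (chartForm_apply_self (diff f) x u).symm

/-- The bracket on the manifold is defined by pulling fields back along the inverse chart. On the
chart target this pullback is `chartField`, the two chart derivatives being mutually inverse. -/
theorem mlieBracket_eq_lieBracket [CompleteSpace E] (X Z : ∀ y : M, TangentSpace 𝓘(ℝ, E) y) (x : M) :
    chartMap x x (VectorField.mlieBracket 𝓘(ℝ, E) X Z x) = VectorField.lieBracket ℝ (chartField X x) (chartField Z x)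
      (extChartAt 𝓘(ℝ, E) x x) := by
  have h : ∀ V : ∀ y : M, TangentSpace 𝓘(ℝ, E) y,
      VectorField.mpullbackWithin 𝓘(ℝ, E) 𝓘(ℝ, E) (extChartAt 𝓘(ℝ, E) x).symm V
        (Set.range 𝓘(ℝ, E)) =ᶠ[𝓝 (extChartAt 𝓘(ℝ, E) x x)] chartField V x := by
    intro V
    filter_upwards [extChartAt_target_mem_nhds (I := 𝓘(ℝ, E)) x] with e he
    rw [VectorField.mpullbackWithin_apply]
    unfold chartField
    rw [ContinuousLinearMap.inverse_eq (mfderivWithin_extChartAt_symm_comp_mfderiv_extChartAt he)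
      (mfderiv_extChartAt_comp_mfderivWithin_extChartAt_symm he)]
    rfl
  have hinv : (chartMap x x : TangentSpace 𝓘(ℝ, E) x →L[ℝ] E).IsInvertible :=
    isInvertible_mfderiv_extChartAt (mem_extChartAt_source x)
  refine (hinv.self_apply_inverse _).trans ?_
  simp only [modelWithCornersSelf_coe, Set.range_id, Set.preimage_univ, Set.univ_inter]
  simp only [modelWithCornersSelf_coe, Set.range_id] at h
  refine (congrFun VectorField.lieBracketWithin_univ _).trans ?_
  exact Filter.EventuallyEq.lieBracket_vectorField_eq (h X) (h Z)

/-- Cartan's formula for the exterior derivative of a one-form. -/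
theorem extD_apply_fields [FiniteDimensional ℝ E] {θ : CovectorField E M}
    {X Z : ∀ y : M, TangentSpace 𝓘(ℝ, E) y} {x : M} (hθ : SmoothFormAt θ x)
    (hX : SmoothFieldAt X x) (hZ : SmoothFieldAt Z x) :
    extD θ x (X x) (Z x) = diff (fun y => θ y (Z y)) x (X x) - diff (fun y => θ y (X y)) x (Z x)
      - θ x (VectorField.mlieBracket 𝓘(ℝ, E) X Z x) := by
  have := FiniteDimensional.complete ℝ E
  have hA := ((SmoothFormAt.contDiffAt_chartForm_self hθ).differentiableAt (by simp)).hasFDerivAt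
  have hd : ∀ V : ∀ y : M, TangentSpace 𝓘(ℝ, E) y, SmoothFieldAt V x →
      ∀ u : TangentSpace 𝓘(ℝ, E) x, diff (fun y => θ y (V y)) x u =
      fderiv ℝ (chartForm θ x) (extChartAt 𝓘(ℝ, E) x x) (chartMap x x u) (chartMap x x (V x)) +
      chartForm θ x (extChartAt 𝓘(ℝ, E) x x)
        (fderiv ℝ (chartField V x) (extChartAt 𝓘(ℝ, E) x x) (chartMap x x u)) := by
    intro V hV u
    have hVd := (hV.contDiffAt_chartField.differentiableAt (by simp)).hasFDerivAt
    rw [diff_eq_fderiv (g := fun e => chartForm θ x e (chartField V x e))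
      ((SmoothFormAt.contMDiffAt_apply hθ hV).mdifferentiableAt (by simp)),
      (hA.clm_apply hVd).fderiv, ← chartField_self]
    · exact add_comm _ _
    · filter_upwards [extChartAt_target_mem_nhds (I := 𝓘(ℝ, E)) x] with e he
      exact (chartForm_chartField θ V he).symm
  rw [hd X hX, hd Z hZ, ← chartForm_apply_self, extD_eq_linD, mlieBracket_eq_lieBracket,
    VectorField.lieBracket, chartField_self, chartField_self, map_sub, linD]
  ring

theorem extD_sub_smul [FiniteDimensional ℝ E] {θ σ : CovectorField E M} {x : M}
    (hθ : SmoothFormAt θ x) (hσ : SmoothFormAt σ x) (t : ℝ) (u v : TangentSpace 𝓘(ℝ, E) x) :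
    extD (θ - t • σ) x u v = extD θ x u v - t * extD σ x u v := by
  have h : chartForm (θ - t • σ) x = chartForm θ x - t • chartForm σ x := rfl
  have h1 := (SmoothFormAt.contDiffAt_chartForm_self hθ).differentiableAt (by simp)
  have h2 := (SmoothFormAt.contDiffAt_chartForm_self hσ).differentiableAt (by simp)
  simp only [extD_eq_linD, h, linD]
  rw [fderiv_sub h1 (h2.const_smul t), fderiv_const_smul h2]
  simp only [sub_apply, smul_apply, smul_eq_mul]
  ring

theorem extD_smul [FiniteDimensional ℝ E] {θ : CovectorField E M} {x : M} {f : M → ℝ}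
    (hθ : SmoothFormAt θ x) (hf : MDifferentiableAt 𝓘(ℝ, E) 𝓘(ℝ, ℝ) f x)
    (u v : TangentSpace 𝓘(ℝ, E) x) :
    extD (f • θ) x u v =
      diff f x u * θ x v - diff f x v * θ x u + f x * extD θ x u v := by
  have h : chartForm (f • θ) x =
      fun e => (f ∘ (extChartAt 𝓘(ℝ, E) x).symm) e • chartForm θ x e := rfl
  have h1 := (SmoothFormAt.contDiffAt_chartForm_self hθ).differentiableAt (by simp)
  have h2 : DifferentiableAt ℝ (f ∘ (extChartAt 𝓘(ℝ, E) x).symm) (extChartAt 𝓘(ℝ, E) x x) := by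
    refine MDifferentiableAt.differentiableAt (MDifferentiableAt.comp _ ?_
      ((contMDiffAt_chart_symm (mem_extChartAt_target x)).mdifferentiableAt (by simp)))
    rwa [extChartAt_to_inv (I := 𝓘(ℝ, E)) x]
  rw [diff_eq_fderiv hf Filter.EventuallyEq.rfl, diff_eq_fderiv hf Filter.EventuallyEq.rfl,
    ← chartForm_apply_self θ, ← chartForm_apply_self θ]
  simp only [extD_eq_linD, h, linD]
  rw [fderiv_fun_smul h2 h1]
  simp only [add_apply, smul_apply, smul_eq_mul,
    ContinuousLinearMap.smulRight_apply, Function.comp, extChartAt_to_inv (I := 𝓘(ℝ, E)) x]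
  ring

/-- In the chart this is the symmetry of the second derivative. -/
theorem extD_diff {f : M → ℝ} (hf : ContMDiff 𝓘(ℝ, E) 𝓘(ℝ, ℝ) ∞ f) (x : M)
    (u v : TangentSpace 𝓘(ℝ, E) x) : extD (diff f) x u v = 0 := by
  have h : chartForm (diff f : CovectorField E M) x =ᶠ[𝓝 (extChartAt 𝓘(ℝ, E) x x)]
      fderiv ℝ (f ∘ (extChartAt 𝓘(ℝ, E) x).symm) := by
    filter_upwards [extChartAt_target_mem_nhds (I := 𝓘(ℝ, E)) x] with e he
    ext u
    exact diff_chartInv he (hf.mdifferentiable (by simp) _) u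
  have h2 : ContDiffAt ℝ ∞ (f ∘ (extChartAt 𝓘(ℝ, E) x).symm) (extChartAt 𝓘(ℝ, E) x x) :=
    (hf.contMDiffAt.comp _ (contMDiffAt_chart_symm (mem_extChartAt_target x))).contDiffAt
  rw [extD_eq_linD, linD_congr h, linD,
    ((h2.of_le (by norm_cast)).isSymmSndFDerivAt (n := 2) (by simp)).eq, sub_self]

set_option synthInstance.maxHeartbeats 200000 in
/-- The identity `d (dA) = 0` for a one-form with `dA = B ∧ A`. -/
theorem linD_cyclic {A B : E → E →L[ℝ] ℝ} {e : E} (hA : ContDiffAt ℝ 2 A e)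
    (hB : DifferentiableAt ℝ B e)
    (h : ∀ᶠ z in 𝓝 e, ∀ u v, linD A z u v = B z u * A z v - B z v * A z u) (u v w : E) :
    linD B e u v * A e w + linD B e v w * A e u + linD B e w u * A e v =
      B e u * linD A e v w + B e v * linD A e w u + B e w * linD A e u v := by
  have hA1 : DifferentiableAt ℝ A e := hA.differentiableAt (by norm_num)
  have hA2 : HasFDerivAt (fderiv ℝ A) (fderiv ℝ (fderiv ℝ A) e) e :=
    ((hA.fderiv_right (m := 1) (by norm_num)).differentiableAt (by norm_num)).hasFDerivAt
  have hs := hA.isSymmSndFDerivAt (by simp)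
  -- Derivative of the equation `dA = B ∧ A` in the direction `w`. In the cyclic sum of three such
  -- identities the left sides cancel, second derivatives of `A` being symmetric.
  have key : ∀ u v w : E, fderiv ℝ (fderiv ℝ A) e w u v - fderiv ℝ (fderiv ℝ A) e w v u =
      (fderiv ℝ B e w u * A e v + B e u * fderiv ℝ A e w v) -
      (fderiv ℝ B e w v * A e u + B e v * fderiv ℝ A e w u) := by
    intro u v w
    have hc : ∀ x : E, HasFDerivAt (fun _ : E => x) (0 : E →L[ℝ] E) e :=
      fun x => hasFDerivAt_const x e
    have h1 := ((hA2.clm_apply (hc u)).clm_apply (hc v)).sub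
      ((hA2.clm_apply (hc v)).clm_apply (hc u))
    have h2 := (((hB.hasFDerivAt.clm_apply (hc u)).mul (hA1.hasFDerivAt.clm_apply (hc v)))).sub
      (((hB.hasFDerivAt.clm_apply (hc v)).mul (hA1.hasFDerivAt.clm_apply (hc u))))
    have h3 := h1.unique (h2.congr_of_eventuallyEq (h.mono fun z hz => hz u v))
    have h4 := congrArg (fun T : E →L[ℝ] ℝ => T w) h3
    simp at h4
    linarith
  have k1 := key u v w
  have k2 := key v w u
  have k3 := key w u v
  have s1 := congrArg (fun T : E →L[ℝ] ℝ => T w) (hs.eq u v)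
  have s2 := congrArg (fun T : E →L[ℝ] ℝ => T u) (hs.eq v w)
  have s3 := congrArg (fun T : E →L[ℝ] ℝ => T v) (hs.eq w u)
  simp only [linD]
  beta_reduce at s1 s2 s3
  linarith

end Charts

/-! ### The foliation, the transverse field and the twist -/

section Foliation

variable {E : Type*} [NormedAddCommGroup E] [NormedSpace ℝ E]
  {Y : Type*} [TopologicalSpace Y] [ChartedSpace E Y] [IsManifold 𝓘(ℝ, E) ∞ Y]
  {lam : CovectorField E Y}

/-! ### The normalised transverse field `R`. -/

namespace TransverseLineField

theorem exists_apply_eq_one (L : TransverseLineField lam) (y : Y) :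
    ∃ r ∈ L.line y, lam y r = 1 := by
  obtain ⟨⟨v, hv⟩, hv0, -⟩ := finrank_eq_one_iff'.1 (L.finrank_line y)
  have h : lam y v ≠ 0 := fun h =>
    hv0 (Subtype.ext ((Submodule.disjoint_def.1 (L.isCompl y).disjoint) v h hv))
  exact ⟨(lam y v)⁻¹ • v, (L.line y).smul_mem _ hv, by simp [h]⟩

/-- The vector field `R` spanning the transverse line field, normalised by `λ(R) = 1`. -/
def field (L : TransverseLineField lam) (y : Y) : TangentSpace 𝓘(ℝ, E) y :=
  (L.exists_apply_eq_one y).choose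

theorem field_mem (L : TransverseLineField lam) (y : Y) : L.field y ∈ L.line y :=
  (L.exists_apply_eq_one y).choose_spec.1

theorem apply_field (L : TransverseLineField lam) (y : Y) : lam y (L.field y) = 1 :=
  (L.exists_apply_eq_one y).choose_spec.2

theorem eq_smul_field (L : TransverseLineField lam) {y : Y} {v : TangentSpace 𝓘(ℝ, E) y}
    (hv : v ∈ L.line y) : v = lam y v • L.field y := by
  have h := (Submodule.disjoint_def.1 (L.isCompl y).disjoint) (v - lam y v • L.field y)
    (by simp [L.apply_field]) ((L.line y).sub_mem hv ((L.line y).smul_mem _ (L.field_mem y)))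
  exact sub_eq_zero.1 h

/-- `R` is chosen pointwise, but the normalisation makes it unique: for any smooth local section `X`
spanning the line field, `R = X / λ(X)`. -/
theorem smoothFieldAt_field (L : TransverseLineField lam) (hs : IsOneForm lam) (y₀ : Y) :
    SmoothFieldAt L.field y₀ := by
  obtain ⟨X, hX, h⟩ := L.smooth y₀
  have hlam := SmoothFormAt.contMDiffAt_apply (hs y₀) hX
  have hX1 : ∀ {y : Y}, L.line y = Submodule.span ℝ {X y} → lam y (X y) ≠ 0 := by
    intro y hy h0
    have h1 := L.eq_smul_field (hy ▸ Submodule.mem_span_singleton_self (X y) : X y ∈ L.line y)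
    rw [h0, zero_smul] at h1
    have h2 := L.finrank_line y
    rw [hy, h1, Submodule.span_zero_singleton, finrank_bot] at h2
    exact zero_ne_one h2
  have hinv : ContMDiffAt 𝓘(ℝ, E) 𝓘(ℝ, ℝ) ∞ (fun y => (lam y (X y))⁻¹) y₀ :=
    hlam.inv₀ (hX1 h.self_of_nhds)
  have h3 := ContMDiffAt.smul_section hinv hX
  refine h3.congr_of_eventuallyEq ?_
  filter_upwards [h] with y hy
  have h1 := L.eq_smul_field (hy ▸ Submodule.mem_span_singleton_self (X y) : X y ∈ L.line y)
  have h4 : L.field y = (lam y (X y))⁻¹ • X y := by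
    rw [eq_inv_smul_iff₀ (hX1 hy)]
    exact h1.symm
  simp only [h4]
  rfl

end TransverseLineField

theorem SmoothFormAt.congr {θ θ' : CovectorField E Y} {y : Y} (h : SmoothFormAt θ y)
    (he : ∀ᶠ z in 𝓝 y, θ' z = θ z) : SmoothFormAt θ' y := by
  refine ContMDiffAt.congr_of_eventuallyEq h ?_
  filter_upwards [he] with z hz
  rw [hz]

theorem SmoothFormAt.sub {θ σ : CovectorField E Y} {y : Y} (h : SmoothFormAt θ y)
    (h' : SmoothFormAt σ y) : SmoothFormAt (θ - σ) y := ContMDiffAt.sub_section h h'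

theorem SmoothFormAt.smul {θ : CovectorField E Y} {f : Y → ℝ} {y : Y} (h : SmoothFormAt θ y)
    (hf : ContMDiffAt 𝓘(ℝ, E) 𝓘(ℝ, ℝ) ∞ f y) : SmoothFormAt (f • θ) y :=
  ContMDiffAt.smul_section hf h

/-- Used with `r = R`, `a = λ(u)`, `b = λ(v)`, when both vectors are projected onto the foliation
along `L`. The `a * b` term vanishes by antisymmetry. -/
theorem extD_sub_smul_vectors (θ : CovectorField E Y) (y : Y) (u v r : TangentSpace 𝓘(ℝ, E) y)
    (a b : ℝ) : extD θ y (u - a • r) (v - b • r) =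
      extD θ y u v - b * extD θ y u r - a * extD θ y r v := by
  simp only [extD_eq_linD, linD, map_sub, map_smul, sub_apply, smul_apply, smul_eq_mul]
  ring

/-! ### Extension of tangential forms by zero, and the form on the graph. -/

section Extend

variable [FiniteDimensional ℝ E] (L : TransverseLineField lam)

theorem extendByZero_apply_leaf (ζ : TangentialForm lam) {y : Y} {w : TangentSpace 𝓘(ℝ, E) y}
    (hw : w ∈ leafTangent lam y) : extendByZero L ζ y w = ζ.1 y ⟨w, hw⟩ := by
  change ζ.1 y ((leafTangent lam y).projectionOnto (L.line y) (L.isCompl y) w) = _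
  rw [Submodule.projectionOnto_apply_of_mem_left _ hw]

theorem extendByZero_apply_field (ζ : TangentialForm lam) (y : Y) :
    extendByZero L ζ y (L.field y) = 0 := by
  change ζ.1 y ((leafTangent lam y).projectionOnto (L.line y) (L.isCompl y) _) = _
  rw [Submodule.projectionOnto_apply_of_mem_right _ (L.field_mem y), map_zero]

theorem restrict_extendByZero (ζ : TangentialForm lam) (y : Y) :
    restrict lam (extendByZero L ζ) y = ζ.1 y := by
  ext w
  exact extendByZero_apply_leaf L ζ w.2

/-- A covector is determined by its restriction to the foliation and its value on `R`. -/
theorem covector_ext {y : Y} {σ τ : Cotangent E y}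
    (h : ∀ w, lam y w = 0 → σ w = τ w) (hR : σ (L.field y) = τ (L.field y)) : σ = τ := by
  ext w
  have h1 := h (w - lam y w • L.field y) (by simp [L.apply_field])
  simp only [map_sub, map_smul, hR, smul_eq_mul] at h1
  linarith

/-- Subtracting `σ(R) λ` does not change `σ` on leaves and kills its value on `R`. The formula is
smooth in `y`, whence the smoothness of the extension. -/
theorem extendByZero_eq (ζ : TangentialForm lam) {y : Y} {σ : CovectorField E Y}
    (h : ζ.1 y = restrict lam σ y) :
    extendByZero L ζ y = σ y - σ y (L.field y) • lam y := by
  refine covector_ext L (fun w hw => ?_) ?_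
  · rw [extendByZero_apply_leaf L ζ hw, h]
    simp [restrict, hw]
  · simp [extendByZero_apply_field, L.apply_field]

theorem smoothFormAt_extendByZero (hs : IsOneForm lam) (ζ : TangentialForm lam) :
    IsOneForm (extendByZero L ζ) := by
  intro y₀
  obtain ⟨σ, hσ, h⟩ := ζ.2 y₀
  have h1 : SmoothFormAt (σ - (fun y => σ y (L.field y)) • lam) y₀ :=
    SmoothFormAt.sub hσ (SmoothFormAt.smul (hs y₀)
      (SmoothFormAt.contMDiffAt_apply hσ (L.smoothFieldAt_field hs y₀)))
  refine SmoothFormAt.congr h1 ?_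
  filter_upwards [h] with y hy
  exact extendByZero_eq L ζ hy

/-- The bundle projection composed with a section is the identity, so the tautological form pulls
back to the section itself. The thickening thus enters only through the forms `λ - t σ`. -/
theorem graphForm_eq (hs : IsOneForm lam) (ζ : TangentialForm lam) :
    graphForm L ζ = lam - extendByZero L ζ := by
  funext y
  have h1 : MDifferentiableAt 𝓘(ℝ, E) (𝓘(ℝ, E).prod 𝓘(ℝ, E →L[ℝ] ℝ)) (graphMap L ζ) y :=
    (smoothFormAt_extendByZero L hs ζ y).mdifferentiableAt (by simp)
  have h2 := mfderiv_comp y (Bundle.mdifferentiableAt_proj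
    (IB := 𝓘(ℝ, E)) (F := E →L[ℝ] ℝ) (E := fun y : Y => Cotangent E y)
    (p := graphMap L ζ y)) h1
  have h3 : (Bundle.TotalSpace.proj ∘ graphMap L ζ : Y → Y) = id := rfl
  ext w
  have h4 : mfderiv (𝓘(ℝ, E).prod 𝓘(ℝ, E →L[ℝ] ℝ)) 𝓘(ℝ, E) Bundle.TotalSpace.proj
      (graphMap L ζ y) (mfderiv 𝓘(ℝ, E) (𝓘(ℝ, E).prod 𝓘(ℝ, E →L[ℝ] ℝ)) (graphMap L ζ) y w) = w := by
    have := congrArg (fun A => A w) h2.symm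
    refine Eq.trans this ?_
    rw [h3, mfderiv_id]
    rfl
  exact congrArg (lam y - extendByZero L ζ y) h4

theorem extendByZero_smul (t : ℝ) (ζ : TangentialForm lam) :
    extendByZero L (t • ζ) = t • extendByZero L ζ := rfl

end Extend

/-! ### Existence of `μ` with `dλ = μ ∧ λ`. -/

section Twist

variable [FiniteDimensional ℝ E]

/-- The one-form `u ↦ dθ (u, R)`. -/
def contractD (θ : CovectorField E Y) (R : ∀ y : Y, TangentSpace 𝓘(ℝ, E) y) :
    CovectorField E Y := fun y =>
  ((fderiv ℝ (chartForm θ y) (extChartAt 𝓘(ℝ, E) y y)).flip (chartMap y y (R y)) -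
    fderiv ℝ (chartForm θ y) (extChartAt 𝓘(ℝ, E) y y) (chartMap y y (R y))).comp (chartMap y y)

theorem contractD_apply (θ : CovectorField E Y) (R : ∀ y : Y, TangentSpace 𝓘(ℝ, E) y) (y : Y)
    (u : TangentSpace 𝓘(ℝ, E) y) : contractD θ R y u = extD θ y u (R y) := rfl

theorem smoothFormAt_contractD {θ : CovectorField E Y} {R : ∀ y : Y, TangentSpace 𝓘(ℝ, E) y}
    (hθ : IsOneForm θ) {y : Y} (hR : SmoothFieldAt R y) : SmoothFormAt (contractD θ R) y := by
  refine smoothFormAt_of_contDiffAt_chartForm (contDiffAt_clm_apply fun u => ?_)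
  have h1 := (SmoothFormAt.contDiffAt_chartForm_self (hθ y)).fderiv_right (m := ∞) (by simp)
  have h2 := hR.contDiffAt_chartField
  have h3 : ContDiffAt ℝ ∞ (fun e => linD (chartForm θ y) e u (chartField R y e))
      (extChartAt 𝓘(ℝ, E) y y) :=
    ((h1.clm_apply contDiffAt_const).clm_apply h2).sub
      ((h1.clm_apply h2).clm_apply contDiffAt_const)
  refine h3.congr_of_eventuallyEq ?_
  filter_upwards [extChartAt_target_mem_nhds (I := 𝓘(ℝ, E)) y] with e he
  rw [chartForm_eq, contractD_apply, extD_eq_linD_symm he (hθ _), chartMap_chartInv he]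
  rfl

variable (L : TransverseLineField lam) (hs : IsOneForm lam)
  (hint : ∀ (y : Y) (u v : TangentSpace 𝓘(ℝ, E) y), lam y u = 0 → lam y v = 0 → extD lam y u v = 0)

include L hs hint in
-- The form `μ = dλ(·, R)` works: expand `dλ(u - λ(u) R, v - λ(v) R) = 0`, which holds because both
-- arguments are leafwise.
theorem isTwist_twist : IsTwist lam (twist lam) := by
  have h : ∃ κ, IsTwist lam κ := by
    have hμ : IsOneForm (contractD lam L.field) := fun y =>
      smoothFormAt_contractD hs (L.smoothFieldAt_field hs y)
    refine ⟨⟨restrict lam (contractD lam L.field), fun y₀ => ⟨_, hμ y₀, .of_forall fun y => rfl⟩⟩,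
      _, hμ, fun y u v => ?_, fun y => rfl⟩
    have h1 := hint y (u - lam y u • L.field y) (v - lam y v • L.field y)
      (by simp [L.apply_field]) (by simp [L.apply_field])
    rw [extD_sub_smul_vectors, extD_swap _ _ (L.field y)] at h1
    simp only [contractD_apply]
    linarith
  rw [twist, dif_pos h]
  exact h.choose_spec

end Twist
end Foliation

/-! ### Infinitesimal deformations are cocycles -/

section Cocycles

variable {E : Type*} [NormedAddCommGroup E] [NormedSpace ℝ E] [FiniteDimensional ℝ E]
  {Y : Type*} [TopologicalSpace Y] [ChartedSpace E Y] [IsManifold 𝓘(ℝ, E) ∞ Y]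
  {lam : CovectorField E Y}

theorem leafEval_of_mem (ζ : ∀ y : Y, leafTangent lam y →L[ℝ] ℝ) {y : Y}
    {w : TangentSpace 𝓘(ℝ, E) y} (hw : w ∈ leafTangent lam y) : leafEval ζ y w = ζ y ⟨w, hw⟩ :=
  dif_pos hw

theorem evalField_eq {ζ : ∀ y : Y, leafTangent lam y →L[ℝ] ℝ} {σ : CovectorField E Y} {y : Y}
    (h : ζ y = restrict lam σ y) (X : TangentField lam) : evalField ζ X y = σ y (X.1 y) := by
  have hX : X.1 y ∈ leafTangent lam y := X.2 y
  rw [evalField, leafEval_of_mem ζ hX, h]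
  rfl

theorem TangentField.smoothFieldAt (X : TangentField lam) (y : Y) : SmoothFieldAt (X.1 ·) y :=
  X.1.contMDiff.contMDiffAt

/-- Frobenius: Cartan's formula for `λ` on `X`, `Z` leaves only `-λ([X, Z])`. Hence the default
value of `leafEval` never occurs in the twisted differential. -/
theorem mlieBracket_mem_leafTangent (hs : IsOneForm lam)
    (hint : ∀ (y : Y) (u v : TangentSpace 𝓘(ℝ, E) y), lam y u = 0 → lam y v = 0 → extD lam y u v = 0)
    (X Z : TangentField lam) (y : Y) :
    VectorField.mlieBracket 𝓘(ℝ, E) X.1 Z.1 y ∈ leafTangent lam y := by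
  have h := extD_apply_fields (hs y) (X.smoothFieldAt y) (Z.smoothFieldAt y)
  have hX : (fun y => lam y (X.1 y)) = fun _ => (0 : ℝ) := funext X.2
  have hZ : (fun y => lam y (Z.1 y)) = fun _ => (0 : ℝ) := funext Z.2
  have h0 : ∀ u : TangentSpace 𝓘(ℝ, E) y, diff (E := E) (fun _ : Y => (0 : ℝ)) y u = 0 := by
    intro u
    unfold diff
    rw [mfderiv_const]
    rfl
  rw [hint y _ _ (X.2 y) (Z.2 y), hX, hZ, h0, h0] at h
  change lam y _ = 0
  linarith

/-- By Cartan's formula, the leafwise differential is the restriction of the ordinary `dσ` for any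
smooth local extension `σ` of `ζ`. This turns identities about `twistedD₁` into pointwise ones. -/
theorem twistedD₁_apply (hs : IsOneForm lam)
    (hint : ∀ (y : Y) (u v : TangentSpace 𝓘(ℝ, E) y), lam y u = 0 → lam y v = 0 → extD lam y u v = 0)
    {μ : CovectorField E Y} (hμ : ∀ y, (twist lam).1 y = restrict lam μ y)
    {ζ : TangentialForm lam} {σ : CovectorField E Y} {y : Y} (hσ : SmoothFormAt σ y)
    (h : ∀ᶠ z in 𝓝 y, ζ.1 z = restrict lam σ z) (X Z : TangentField lam) :
    twistedD₁ lam ζ X Z y = extD σ y (X.1 y) (Z.1 y)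
      - (μ y (X.1 y) * σ y (Z.1 y) - μ y (Z.1 y) * σ y (X.1 y)) := by
  have hd : ∀ (X : TangentField lam) (u : TangentSpace 𝓘(ℝ, E) y),
      diff (evalField ζ.1 X) y u = diff (fun z => σ z (X.1 z)) y u := by
    intro X u
    have : evalField ζ.1 X =ᶠ[𝓝 y] fun z => σ z (X.1 z) := by
      filter_upwards [h] with z hz
      exact evalField_eq hz X
    exact congrArg (fun A : E →L[ℝ] ℝ => A u) this.mfderiv_eq
  have h1 : twistedD₁ lam ζ X Z y = diff (evalField ζ.1 Z) y (X.1 y)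
      - diff (evalField ζ.1 X) y (Z.1 y)
      - leafEval ζ.1 y (VectorField.mlieBracket 𝓘(ℝ, E) X.1 Z.1 y)
      - (evalField (twist lam).1 X y * evalField ζ.1 Z y
        - evalField (twist lam).1 Z y * evalField ζ.1 X y) := rfl
  rw [h1, hd, hd, leafEval_of_mem _ (mlieBracket_mem_leafTangent hs hint X Z y),
    evalField_eq (hμ y), evalField_eq (hμ y), evalField_eq h.self_of_nhds,
    evalField_eq h.self_of_nhds, h.self_of_nhds,
    extD_apply_fields hσ (X.smoothFieldAt y) (Z.smoothFieldAt y)]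
  rfl

/-- From `d(μ ∧ λ) = d(dλ) = 0` one gets `dμ ∧ λ = μ ∧ dλ = μ ∧ μ ∧ λ = 0`. Evaluation on `(u, v,
R)` leaves `dμ(u, v)`. -/
theorem extD_twist_eq_zero (L : TransverseLineField lam) (hs : IsOneForm lam)
    {μ : CovectorField E Y} (hμs : IsOneForm μ)
    (hμ : ∀ (y : Y) (u v : TangentSpace 𝓘(ℝ, E) y),
      extD lam y u v = μ y u * lam y v - μ y v * lam y u) {y : Y} {u v : TangentSpace 𝓘(ℝ, E) y}
    (hu : lam y u = 0) (hv : lam y v = 0) : extD μ y u v = 0 := by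
  have h := linD_cyclic ((SmoothFormAt.contDiffAt_chartForm_self (hs y)).of_le (by norm_cast))
    ((SmoothFormAt.contDiffAt_chartForm_self (hμs y)).differentiableAt (by simp)) ?_
    (chartMap y y u) (chartMap y y v) (chartMap y y (L.field y))
  · simp only [← extD_eq_linD, hμ, chartForm_apply_self, hu, hv, L.apply_field] at h
    linarith
  · filter_upwards [extChartAt_target_mem_nhds (I := 𝓘(ℝ, E)) y] with e he u v
    rw [← extD_chartInv he (hs _), hμ]
    rfl

/-- Every vector tangent to the foliation extends to a vector field tangent to the foliation. -/
theorem exists_tangentField [T2Space Y] [SigmaCompactSpace Y] (L : TransverseLineField lam)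
    (hs : IsOneForm lam) {y₀ : Y} {u : TangentSpace 𝓘(ℝ, E) y₀} (hu : lam y₀ u = 0) :
    ∃ X : TangentField lam, X.1 y₀ = u := by
  classical
  -- A convex constraint on each fibre: nothing off `y₀`, the value `u` at `y₀`. A partition of
  -- unity glues local extensions subject to it; the result is then projected onto the foliation
  -- along `R`.
  let t : ∀ y : Y, Set (TangentSpace 𝓘(ℝ, E) y) := fun y => {w | ∀ h : y = y₀, h ▸ w = u}
  have hconv : ∀ y, Convex ℝ (t y) := by
    intro y
    by_cases h : y = y₀
    · subst h
      intro a ha b hb p q _ _ hpq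
      have ha' : a = u := ha rfl
      have hb' : b = u := hb rfl
      intro _
      change p • a + q • b = u
      rw [ha', hb', ← add_smul, hpq, one_smul]
    · have : t y = Set.univ := Set.eq_univ_of_forall fun w h' => absurd h' h
      rw [this]
      exact convex_univ
  obtain ⟨s, hs'⟩ := exists_contMDiffSection_forall_mem_convex_of_local (F_fiber := E) (n := ⊤)
    𝓘(ℝ, E) (fun y : Y => TangentSpace 𝓘(ℝ, E) y) t hconv (by
      intro x₀
      by_cases h : x₀ = y₀
      · subst h
        obtain ⟨U, hU, hU'⟩ := FiberBundle.exists_contMDiffOn_extend (k := ∞) 𝓘(ℝ, E) E u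
        refine ⟨U, hU, FiberBundle.extend E u, hU', fun y hy hyy => ?_⟩
        subst hyy
        simp
      · exact ⟨{y₀}ᶜ, isOpen_compl_singleton.mem_nhds h, fun _ => 0,
          (Bundle.contMDiff_zeroSection ℝ _).contMDiffOn, fun y hy hyy => absurd hyy hy⟩)
  have hsm : ∀ y, SmoothFieldAt (s ·) y := fun y => s.contMDiff.contMDiffAt
  have hX : ∀ y, SmoothFieldAt (fun y => s y - lam y (s y) • L.field y) y := fun y =>
    ContMDiffAt.sub_section (hsm y) (ContMDiffAt.smul_section
      (SmoothFormAt.contMDiffAt_apply (hs y) (hsm y)) (L.smoothFieldAt_field hs y))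
  refine ⟨⟨⟨fun y => s y - lam y (s y) • L.field y, hX⟩, fun y => ?_⟩, ?_⟩
  · change lam y (s y - lam y (s y) • L.field y) = 0
    simp [L.apply_field]
  · change s y₀ - lam y₀ (s y₀) • L.field y₀ = u
    have h0 : s y₀ = u := hs' y₀ rfl
    rw [h0, hu, zero_smul, sub_zero]

variable (L : TransverseLineField lam) (hs : IsOneForm lam)
  (hint : ∀ (y : Y) (u v : TangentSpace 𝓘(ℝ, E) y), lam y u = 0 → lam y v = 0 → extD lam y u v = 0)

include L hs hint in
-- With the global extension `df - fμ`, the terms `df ∧ μ` and `μ ∧ df` cancel, leaving `-f dμ`,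
-- which is zero on leaves.
theorem twistedD₁_twistedD₀ (f : C^∞⟮𝓘(ℝ, E), Y; ℝ⟯) : twistedD₁ lam (twistedD₀ lam f) = 0 := by
  obtain ⟨μ, hμs, hμ, hκ⟩ := isTwist_twist L hs hint
  funext X Z y
  have hf := f.contMDiff.contMDiffAt (x := y)
  have h1 : SmoothFormAt (diff f - ⇑f • μ) y :=
    SmoothFormAt.sub (smoothFormAt_diff f y) (SmoothFormAt.smul (hμs y) hf)
  rw [twistedD₁_apply hs hint hκ h1 (.of_forall fun z => ?_)]
  · have h2 := extD_sub_smul (smoothFormAt_diff f y) (SmoothFormAt.smul (hμs y) hf) 1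
      (X.1 y) (Z.1 y)
    rw [one_smul] at h2
    rw [h2, extD_diff f.contMDiff, extD_smul (hμs y) (hf.mdifferentiableAt (by simp)),
      extD_twist_eq_zero L hs hμs hμ (X.2 y) (Z.2 y)]
    change _ - (_ * (diff f y (Z.1 y) - f y * μ y (Z.1 y)) -
      _ * (diff f y (X.1 y) - f y * μ y (X.1 y))) = (0 : ℝ)
    ring
  · change restrict lam (diff f) z - f z • (twist lam).1 z = _
    rw [hκ]
    rfl

include hs hint in
-- The differential is given by its values on tangent fields, and every leafwise vector extends to
-- such a field, so its vanishing is a condition on vectors.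
theorem twistedD₁_eq_zero_iff [T2Space Y] [SigmaCompactSpace Y] {μ : CovectorField E Y}
    (hμ : ∀ y, (twist lam).1 y = restrict lam μ y) (ζ : TangentialForm lam) :
    twistedD₁ lam ζ = 0 ↔ ∀ (y : Y) (u v : TangentSpace 𝓘(ℝ, E) y), lam y u = 0 → lam y v = 0 →
      extD (extendByZero L ζ) y u v =
        μ y u * extendByZero L ζ y v - μ y v * extendByZero L ζ y u := by
  have hform := fun (X Z : TangentField lam) (y : Y) => twistedD₁_apply hs hint hμ
    (smoothFormAt_extendByZero L hs ζ y)
    (.of_forall fun z => (restrict_extendByZero L ζ z).symm) X Z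
  constructor
  · intro h y u v hu hv
    obtain ⟨X, rfl⟩ := exists_tangentField L hs hu
    obtain ⟨Z, rfl⟩ := exists_tangentField L hs hv
    have h1 := hform X Z y
    rw [h] at h1
    exact (sub_eq_zero.1 h1.symm)
  · intro h
    funext X Z y
    rw [hform X Z y, h y _ _ (X.2 y) (Z.2 y)]
    exact sub_self _

include hs hint in
-- The linearized equation is `σ ∧ dλ + λ ∧ dσ = 0`, to be compared with `dσ = μ ∧ σ` on leaves.
theorem isInfinitesimalDeformation_iff [T2Space Y] [SigmaCompactSpace Y] (ζ : TangentialForm lam) :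
    IsInfinitesimalDeformation L ζ ↔ twistedD₁ lam ζ = 0 := by
  obtain ⟨μ, hμs, hμ, hκ⟩ := isTwist_twist L hs hint
  rw [twistedD₁_eq_zero_iff L hs hint hκ]
  set σ := extendByZero L ζ with hσ
  have hσs : IsOneForm σ := smoothFormAt_extendByZero L hs ζ
  have hzero : IsCoisotropicGraph L (0 : TangentialForm lam) := by
    intro y u v w
    have h0 : graphForm L (0 : TangentialForm lam) = lam := by
      have : (0 : TangentialForm lam) = (0 : ℝ) • 0 := (zero_smul ℝ _).symm
      rw [graphForm_eq L hs, this, extendByZero_smul, zero_smul, sub_zero]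
    rw [h0, wedgeExtD, hμ, hμ, hμ]
    ring
  have hderiv : ∀ (y : Y) (u v w : TangentSpace 𝓘(ℝ, E) y),
      HasDerivAt (fun t : ℝ => wedgeExtD (graphForm L (t • ζ)) y u v w)
        (-(σ y u * extD lam y v w + lam y u * extD σ y v w
          + (σ y v * extD lam y w u + lam y v * extD σ y w u)
          + (σ y w * extD lam y u v + lam y w * extD σ y u v))) 0 := by
    intro y u v w
    have h1 : (fun t : ℝ => wedgeExtD (graphForm L (t • ζ)) y u v w) = fun t : ℝ =>
        (lam y u - t * σ y u) * (extD lam y v w - t * extD σ y v w) +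
        (lam y v - t * σ y v) * (extD lam y w u - t * extD σ y w u) +
        (lam y w - t * σ y w) * (extD lam y u v - t * extD σ y u v) := by
      funext t
      rw [graphForm_eq L hs, extendByZero_smul, wedgeExtD, extD_sub_smul (hs y) (hσs y),
        extD_sub_smul (hs y) (hσs y), extD_sub_smul (hs y) (hσs y)]
      rfl
    have h2 : ∀ a b : ℝ, HasDerivAt (fun t : ℝ => a - t * b) (-b) 0 := fun a b => by
      simpa using ((hasDerivAt_id (0 : ℝ)).mul_const b).const_sub a
    rw [h1]
    refine ((((h2 _ _).mul (h2 _ _)).add ((h2 _ _).mul (h2 _ _))).add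
      ((h2 _ _).mul (h2 _ _))).congr_deriv ?_
    ring
  constructor
  · rintro ⟨-, h⟩ y u v hu hv
    -- On `(R, u, v)` one has `λ(R) = 1`, `dλ(u, v) = 0`, `dλ(v, R) = μ(v)` and `dλ(R, u) = -μ(u)`,
    -- which leaves the cocycle equation.
    have h1 := (h y (L.field y) u v).unique (hderiv y (L.field y) u v)
    rw [hμ, hμ, hμ, hu, hv, L.apply_field] at h1
    linarith
  · intro h
    refine ⟨hzero, fun y u v w => (hderiv y u v w).congr_deriv ?_⟩
    -- Projecting `u`, `v` onto the foliation along `R` gives `dσ = μ ∧ σ + ρ ∧ λ` for some covector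
    -- `ρ`. Then `λ ∧ dσ = λ ∧ μ ∧ σ` cancels `σ ∧ dλ = σ ∧ μ ∧ λ`.
    have key : ∀ u v : TangentSpace 𝓘(ℝ, E) y, extD σ y u v =
        μ y u * σ y v - μ y v * σ y u +
          lam y v * (extD σ y u (L.field y) - (μ y u * σ y (L.field y) - μ y (L.field y) * σ y u)) -
          lam y u * (extD σ y v (L.field y) - (μ y v * σ y (L.field y) - μ y (L.field y) * σ y v))
          := by
      intro u v
      have h1 := h y (u - lam y u • L.field y) (v - lam y v • L.field y)
        (by simp [L.apply_field]) (by simp [L.apply_field])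
      rw [extD_sub_smul_vectors, extD_swap _ _ (L.field y)] at h1
      simp only [map_sub, map_smul, smul_eq_mul] at h1
      linear_combination h1
    rw [key u v, key v w, key w u, hμ, hμ, hμ]
    ring

end Cocycles

/-! ### Derivative of a pullback along an isotopy -/

section Isotopies

variable {E : Type*} [NormedAddCommGroup E] [NormedSpace ℝ E]

set_option synthInstance.maxHeartbeats 200000 in
/-- The Lie derivative of a one-form on a normed space. -/
theorem hasDerivAt_pullback_model {F : ℝ × E → E} {e : E} (hF : ContDiffAt ℝ 2 F (0, e))
    (h0 : ∀ᶠ z in 𝓝 e, F (0, z) = z) {A : E → E →L[ℝ] ℝ} (hA : DifferentiableAt ℝ A e) (w : E) :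
    HasDerivAt (fun t : ℝ => A (F (t, e)) (fderiv ℝ F (t, e) (0, w)))
      (fderiv ℝ A e (fderiv ℝ F (0, e) (1, 0)) w +
        A e (fderiv ℝ (fun z => fderiv ℝ F (0, z) (1, 0)) e w)) 0 := by
  have he : F (0, e) = e := h0.self_of_nhds
  have hF1 : HasFDerivAt F (fderiv ℝ F (0, e)) (0, e) :=
    (hF.differentiableAt (by norm_num)).hasFDerivAt
  have hF2 : HasFDerivAt (fderiv ℝ F) (fderiv ℝ (fderiv ℝ F) (0, e)) (0, e) :=
    ((hF.fderiv_right (m := 1) (by norm_num)).differentiableAt (by norm_num)).hasFDerivAt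
  have hsymm := hF.isSymmSndFDerivAt (by simp)
  have hl : HasDerivAt (fun t : ℝ => (t, e)) ((1 : ℝ), (0 : E)) 0 :=
    (hasDerivAt_id (0 : ℝ)).prodMk (hasDerivAt_const 0 e)
  have hr : HasFDerivAt (fun z : E => ((0 : ℝ), z)) (ContinuousLinearMap.inr ℝ ℝ E) e :=
    (ContinuousLinearMap.inr ℝ ℝ E).hasFDerivAt
  have h1 : HasDerivAt (fun t : ℝ => F (t, e)) (fderiv ℝ F (0, e) (1, 0)) 0 :=
    hF1.comp_hasDerivAt 0 hl
  have h2 : HasDerivAt (fun t : ℝ => A (F (t, e))) (fderiv ℝ A e (fderiv ℝ F (0, e) (1, 0))) 0 := by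
    have hA' : HasFDerivAt A (fderiv ℝ A e) (F (0, e)) := by rw [he]; exact hA.hasFDerivAt
    exact hA'.comp_hasDerivAt 0 h1
  have h3 : HasDerivAt (fun t : ℝ => fderiv ℝ F (t, e)) (fderiv ℝ (fderiv ℝ F) (0, e) (1, 0)) 0 :=
    hF2.comp_hasDerivAt 0 hl
  have h4 : fderiv ℝ (fun z => fderiv ℝ F (0, z) (1, 0)) e w =
      fderiv ℝ (fderiv ℝ F) (0, e) (0, w) (1, 0) := by
    have h5 : HasFDerivAt (fun z => fderiv ℝ F (0, z))
        ((fderiv ℝ (fderiv ℝ F) (0, e)).comp (ContinuousLinearMap.inr ℝ ℝ E)) e := hF2.comp e hr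
    have h6 := h5.clm_apply (hasFDerivAt_const ((1 : ℝ), (0 : E)) e)
    rw [h6.fderiv]
    simp
  have h5 : fderiv ℝ F (0, e) (0, w) = w := by
    have h6 : HasFDerivAt (fun z => F (0, z))
      ((fderiv ℝ F (0, e)).comp (ContinuousLinearMap.inr ℝ ℝ E)) e := hF1.comp e hr
    have h7 := h6.unique ((hasFDerivAt_id e).congr_of_eventuallyEq h0)
    exact congrArg (fun T : E →L[ℝ] E => T w) h7
  refine (h2.clm_apply (h3.clm_apply (hasDerivAt_const (0 : ℝ) ((0 : ℝ), w)))).congr_deriv ?_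
  -- Mixed partial derivatives commute: the time derivative of the spatial derivative is the spatial
  -- derivative of the velocity.
  rw [h4, hsymm.eq (0, w) (1, 0), he, h5]
  simp

variable {Y : Type*} [TopologicalSpace Y] [ChartedSpace E Y] [IsManifold 𝓘(ℝ, E) ∞ Y]

namespace AmbientIsotopy

variable (ψ : AmbientIsotopy E Y)

/-- The velocity field of an isotopy at time zero. -/
def velocity (y : Y) : TangentSpace 𝓘(ℝ, E) y :=
  (mfderiv 𝓘(ℝ, ℝ) 𝓘(ℝ, E) (fun t : ℝ => ψ.toDiffeo t y) 0 : ℝ →L[ℝ] E) 1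

/-- An isotopy in the preferred chart at `y`. -/
def inChart (y : Y) : ℝ × E → E := fun p =>
  extChartAt 𝓘(ℝ, E) y (ψ.toDiffeo p.1 ((extChartAt 𝓘(ℝ, E) y).symm p.2))

theorem contDiffAt_inChart (y : Y) {e : E} (he : e ∈ (extChartAt 𝓘(ℝ, E) y).target) :
    ContDiffAt ℝ ∞ (ψ.inChart y) (0, e) := by
  have h1 : ContMDiffAt 𝓘(ℝ, ℝ × E) (𝓘(ℝ, ℝ).prod 𝓘(ℝ, E)) ∞
      (fun p : ℝ × E => (p.1, (extChartAt 𝓘(ℝ, E) y).symm p.2)) (0, e) :=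
    contDiff_fst.contMDiff.contMDiffAt.prodMk
      ((contMDiffAt_chart_symm he).comp (0, e) contDiff_snd.contMDiff.contMDiffAt)
  have h2 := ψ.smooth.contMDiffAt.comp (0, e) h1
  refine ContMDiffAt.contDiffAt ((contMDiffAt_chart ?_).comp (0, e) h2)
  simp only
  rw [ψ.map_zero]
  exact (extChartAt 𝓘(ℝ, E) y).map_target he

theorem inChart_zero (y : Y) {e : E} (he : e ∈ (extChartAt 𝓘(ℝ, E) y).target) :
    ψ.inChart y (0, e) = e := by
  simp only [inChart, ψ.map_zero]
  exact (extChartAt 𝓘(ℝ, E) y).right_inv he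

theorem contMDiff_orbit (y : Y) : ContMDiff 𝓘(ℝ, ℝ) 𝓘(ℝ, E) ∞ (fun t : ℝ => ψ.toDiffeo t y) :=
  ψ.smooth.comp (contMDiff_id.prodMk contMDiff_const)

theorem chartField_velocity (y : Y) {e : E} (he : e ∈ (extChartAt 𝓘(ℝ, E) y).target) :
    chartField ψ.velocity y e = fderiv ℝ (ψ.inChart y) (0, e) (1, 0) := by
  set z := (extChartAt 𝓘(ℝ, E) y).symm e with hz
  have hzs : z ∈ (extChartAt 𝓘(ℝ, E) y).source := (extChartAt 𝓘(ℝ, E) y).map_target he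
  have hl : HasDerivAt (fun t : ℝ => (t, e)) ((1 : ℝ), (0 : E)) 0 :=
    (hasDerivAt_id (0 : ℝ)).prodMk (hasDerivAt_const 0 e)
  have hd : HasFDerivAt (ψ.inChart y) (fderiv ℝ (ψ.inChart y) (0, e)) (0, e) :=
    ((ψ.contDiffAt_inChart y he).differentiableAt (by simp)).hasFDerivAt
  have h1 : HasDerivAt (fun t : ℝ => ψ.inChart y (t, e)) (fderiv ℝ (ψ.inChart y) (0, e) (1, 0)) 0 :=
    HasFDerivAt.comp_hasDerivAt (f := fun t : ℝ => (t, e)) 0 hd hl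
  have h0 : ψ.toDiffeo 0 z ∈ (extChartAt 𝓘(ℝ, E) y).source := by rwa [ψ.map_zero]
  have h2 := mfderiv_comp (0 : ℝ) ((contMDiffAt_chart h0).mdifferentiableAt (by simp))
    ((ψ.contMDiff_orbit z).mdifferentiable (by simp) 0)
  rw [mfderiv_eq_fderiv] at h2
  have h3 := congrArg (fun A : ℝ →L[ℝ] E => A 1) h2
  -- The chain rule gives the chart derivative at `ψ_0(z)`, which has to be replaced by the one at
  -- `z`.
  let C : Y → E →L[ℝ] E := fun z => chartMap y z
  have hC : C (ψ.toDiffeo 0 z) = C z := by rw [ψ.map_zero]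
  have h4 := congrArg (fun A : E →L[ℝ] E => A (ψ.velocity z)) hC
  refine (h4.symm.trans h3.symm).trans ?_
  exact congrArg (fun A : ℝ →L[ℝ] E => A 1) h1.hasFDerivAt.fderiv |>.trans (by simp)

theorem contMDiff_apply_velocity [FiniteDimensional ℝ E] {θ : CovectorField E Y}
    (hθ : IsOneForm θ) : ContMDiff 𝓘(ℝ, E) 𝓘(ℝ, ℝ) ∞ (fun y => θ y (ψ.velocity y)) := by
  intro y
  have h1 : ContDiffAt ℝ ∞ (fun e => chartForm θ y e (fderiv ℝ (ψ.inChart y) (0, e) (1, 0)))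
      (extChartAt 𝓘(ℝ, E) y y) := by
    have h2 := (ψ.contDiffAt_inChart y (mem_extChartAt_target y)).fderiv_right (m := ∞) (by simp)
    have h3 : ContDiffAt ℝ ∞ (fun e : E => ((0 : ℝ), e)) (extChartAt 𝓘(ℝ, E) y y) :=
      contDiffAt_const.prodMk contDiffAt_id
    exact (SmoothFormAt.contDiffAt_chartForm_self (hθ y)).clm_apply
      ((h2.comp _ h3).clm_apply contDiffAt_const)
  refine (h1.contMDiffAt.comp y (contMDiffAt_chart (mem_extChartAt_source y))).congr_of_eventuallyEq
    ?_
  filter_upwards [extChartAt_source_mem_nhds (I := 𝓘(ℝ, E)) y] with z hz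
  have ht := (extChartAt 𝓘(ℝ, E) y).map_source hz
  have h4 := chartForm_chartField θ ψ.velocity ht
  rw [ψ.chartField_velocity y ht, (extChartAt 𝓘(ℝ, E) y).left_inv hz] at h4
  exact h4.symm

/-- For small `t` the point `ψ_t(y)` stays in the chart at `y`, so one chart serves for both ends
and `hasDerivAt_pullback_model` applies. -/
theorem eventually_pullbackForm_eq (θ : CovectorField E Y) (y : Y) (w : TangentSpace 𝓘(ℝ, E) y) :
    ∀ᶠ t : ℝ in 𝓝 0, pullbackForm (ψ.toDiffeo t) θ y w =
      chartForm θ y (ψ.inChart y (t, extChartAt 𝓘(ℝ, E) y y))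
        (fderiv ℝ (ψ.inChart y) (t, extChartAt 𝓘(ℝ, E) y y) (0, chartMap y y w)) := by
  set e := extChartAt 𝓘(ℝ, E) y y with he
  have h1 : ∀ᶠ t : ℝ in 𝓝 0, ψ.toDiffeo t y ∈ (extChartAt 𝓘(ℝ, E) y).source := by
    refine (ψ.contMDiff_orbit y).continuous.continuousAt.eventually_mem ?_
    rw [ψ.map_zero]
    exact extChartAt_source_mem_nhds y
  have h2 : ∀ᶠ t : ℝ in 𝓝 0, DifferentiableAt ℝ (ψ.inChart y) (t, e) := by
    have h3 := ((ψ.contDiffAt_inChart y (mem_extChartAt_target y)).of_le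
      (by simp : (1 : WithTop ℕ∞) ≤ ∞)).eventually (by simp)
    have h4 : Filter.Tendsto (fun t : ℝ => (t, e)) (𝓝 0) (𝓝 (0, e)) :=
      (Continuous.prodMk_left e).tendsto 0
    filter_upwards [h4.eventually h3] with t ht
    exact ht.differentiableAt (by simp)
  filter_upwards [h1, h2] with t ht1 ht2
  have h3 : extChartAt 𝓘(ℝ, E) y ∘ ψ.toDiffeo t =ᶠ[𝓝 y]
      (fun z => ψ.inChart y (t, z)) ∘ extChartAt 𝓘(ℝ, E) y := by
    filter_upwards [extChartAt_source_mem_nhds (I := 𝓘(ℝ, E)) y] with z hz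
    simp only [Function.comp, inChart, (extChartAt 𝓘(ℝ, E) y).left_inv hz]
  have h4 : HasFDerivAt (fun z => ψ.inChart y (t, z))
      ((fderiv ℝ (ψ.inChart y) (t, e)).comp (ContinuousLinearMap.inr ℝ ℝ E)) e :=
    ht2.hasFDerivAt.comp e (hasFDerivAt_prodMk_right t e)
  have h5 := mfderiv_comp y ((contMDiffAt_chart ht1).mdifferentiableAt (by simp))
    ((ψ.toDiffeo t).contMDiff.mdifferentiable (by simp) y)
  have h4' : HasMFDerivAt 𝓘(ℝ, E) 𝓘(ℝ, E) (fun z => ψ.inChart y (t, z)) (extChartAt 𝓘(ℝ, E) y y)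
      ((fderiv ℝ (ψ.inChart y) (t, e)).comp (ContinuousLinearMap.inr ℝ ℝ E)) := h4.hasMFDerivAt
  have h6 := (h4'.comp y ((contMDiffAt_chart
    (mem_extChartAt_source (I := 𝓘(ℝ, E)) y)).mdifferentiableAt (by simp)).hasMFDerivAt).mfderiv
  have h7 : (mfderiv 𝓘(ℝ, E) 𝓘(ℝ, E) (extChartAt 𝓘(ℝ, E) y ∘ ψ.toDiffeo t) y : E →L[ℝ] E) =
    mfderiv 𝓘(ℝ, E) 𝓘(ℝ, E) ((fun z => ψ.inChart y (t, z)) ∘ extChartAt 𝓘(ℝ, E) y) y :=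
    h3.mfderiv_eq
  have h8 := congrArg (fun A : E →L[ℝ] E => A w) ((h5.symm.trans h7).trans h6)
  have h9 : chartMap y (ψ.toDiffeo t y) (mfderiv 𝓘(ℝ, E) 𝓘(ℝ, E) (ψ.toDiffeo t) y w) =
    fderiv ℝ (ψ.inChart y) (t, e) (0, chartMap y y w) := h8
  rw [← h9]
  have h10 : ψ.inChart y (t, e) = extChartAt 𝓘(ℝ, E) y (ψ.toDiffeo t y) := by
    simp only [inChart, he, extChartAt_to_inv]
  rw [h10, chartForm_apply θ ht1]
  rfl

/-- The Lie derivative of a one-form along an isotopy, by Cartan's magic formula. -/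
theorem hasDerivAt_pullbackForm [FiniteDimensional ℝ E] {θ : CovectorField E Y}
    (hθ : IsOneForm θ) (y : Y) (w : TangentSpace 𝓘(ℝ, E) y) :
    HasDerivAt (fun t : ℝ => pullbackForm (ψ.toDiffeo t) θ y w)
      (diff (fun y => θ y (ψ.velocity y)) y w + extD θ y (ψ.velocity y) w) 0 := by
  have hy := mem_extChartAt_target (I := 𝓘(ℝ, E)) y
  have hc := SmoothFormAt.contDiffAt_chartForm_self (hθ y)
  have hA := hc.differentiableAt (by simp)
  have hF := ψ.contDiffAt_inChart y hy
  have h1 := hasDerivAt_pullback_model (hF.of_le (by norm_cast))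
    (Filter.eventually_of_mem (extChartAt_target_mem_nhds y) fun e he => ψ.inChart_zero y he)
    hA (chartMap y y w)
  refine (h1.congr_of_eventuallyEq (ψ.eventually_pullbackForm_eq θ y w)).congr_deriv ?_
  have hV : DifferentiableAt ℝ (fun z => fderiv ℝ (ψ.inChart y) (0, z) (1, 0))
      (extChartAt 𝓘(ℝ, E) y y) := by
    have h2 := (hF.fderiv_right (m := ∞) (by simp)).differentiableAt (by simp)
    have h3 : DifferentiableAt ℝ (fun e : E => ((0 : ℝ), e)) (extChartAt 𝓘(ℝ, E) y y) :=
      (differentiableAt_const _).prodMk differentiableAt_id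
    exact (h2.comp _ h3).clm_apply (differentiableAt_const _)
  have hvel : fderiv ℝ (ψ.inChart y) (0, extChartAt 𝓘(ℝ, E) y y) (1, 0) =
      chartMap y y (ψ.velocity y) := by
    rw [← ψ.chartField_velocity y hy, chartField_self]
  rw [diff_eq_fderiv (g := fun e => chartForm θ y e (fderiv ℝ (ψ.inChart y) (0, e) (1, 0)))
    ((ψ.contMDiff_apply_velocity hθ).mdifferentiable (by simp) y),
    (hA.hasFDerivAt.clm_apply hV.hasFDerivAt).fderiv, extD_eq_linD, linD]
  · simp only [add_apply, ContinuousLinearMap.comp_apply, ContinuousLinearMap.flip_apply, hvel]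
    ring
  · filter_upwards [extChartAt_target_mem_nhds (I := 𝓘(ℝ, E)) y] with e he
    rw [← ψ.chartField_velocity y he, chartForm_chartField θ _ he]
    rfl

theorem pullbackForm_zero (θ : CovectorField E Y) (y : Y) :
    (pullbackForm (ψ.toDiffeo 0) θ : CovectorField E Y) y = θ y := by
  have h : (pullbackForm (ψ.toDiffeo 0) θ : CovectorField E Y) y = pullbackForm id θ y :=
    pullbackForm_congr θ (.of_forall ψ.map_zero)
  rw [h, pullbackForm, mfderiv_id]
  rfl

end AmbientIsotopy

end Isotopies

/-! ### First-order action of an isotopy -/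

section Gauge

variable {E : Type*} [NormedAddCommGroup E] [NormedSpace ℝ E] [FiniteDimensional ℝ E]
  {Y : Type*} [TopologicalSpace Y] [ChartedSpace E Y] [IsManifold 𝓘(ℝ, E) ∞ Y]
  {lam : CovectorField E Y}

/-- The function `λ(V)`, for `V` the velocity of an isotopy. -/
def AmbientIsotopy.hamiltonian (ψ : AmbientIsotopy E Y) (hs : IsOneForm lam) :
    C^∞⟮𝓘(ℝ, E), Y; ℝ⟯ :=
  ⟨fun y => lam y (ψ.velocity y), ψ.contMDiff_apply_velocity hs⟩

variable (L : TransverseLineField lam) (hs : IsOneForm lam)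
  (hint : ∀ (y : Y) (u v : TangentSpace 𝓘(ℝ, E) y), lam y u = 0 → lam y v = 0 → extD lam y u v = 0)

include hs in
/-- The derivative at `t = 0` of `ψ_t^* (λ - t ζ₁) - g_t (λ - t ζ₀)`. -/
theorem hasDerivAt_carries (ψ : AmbientIsotopy E Y) (ζ₀ ζ₁ : TangentialForm lam) {g : ℝ → Y → ℝ}
    {y : Y} {G : ℝ} (hg : HasDerivAt (fun t => g t y) G 0) (hg0 : g 0 y = 1)
    (w : TangentSpace 𝓘(ℝ, E) y) :
    HasDerivAt (fun t : ℝ => pullbackForm (ψ.toDiffeo t) (lam - t • extendByZero L ζ₁) y w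
        - g t y * (lam - t • extendByZero L ζ₀) y w)
      (diff (ψ.hamiltonian hs) y w + extD lam y (ψ.velocity y) w - extendByZero L ζ₁ y w
        - (G * lam y w - extendByZero L ζ₀ y w)) 0 := by
  have h1 := ψ.hasDerivAt_pullbackForm hs y w
  have h2 := ψ.hasDerivAt_pullbackForm (smoothFormAt_extendByZero L hs ζ₁) y w
  have h3 := (hasDerivAt_id (0 : ℝ)).mul h2
  have h4 : HasDerivAt (fun t : ℝ => lam y w - t * extendByZero L ζ₀ y w)
      (-extendByZero L ζ₀ y w) 0 := by
    simpa using ((hasDerivAt_id (0 : ℝ)).mul_const (extendByZero L ζ₀ y w)).const_sub (lam y w)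
  refine ((h1.sub h3).sub (hg.mul h4)).congr_deriv ?_
  rw [ψ.pullbackForm_zero, hg0]
  simp only [id, zero_mul, add_zero, one_mul, sub_zero]
  change _ = diff (fun y => lam y (ψ.velocity y)) y w + _ - _ - _
  ring

include hs hint in
-- The derivative in `hasDerivAt_carries` vanishes on leaves exactly when `ζ₁ - ζ₀ = d_F f - f π(μ)`
-- for `f = λ(V)`, since `dλ(V, w) = -f μ(w)` if `λ(w) = 0`. Its value on `R` can be made zero by
-- the choice of `g`.
theorem carriesToFirstOrder_iff (ψ : AmbientIsotopy E Y) (ζ₀ ζ₁ : TangentialForm lam) :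
    CarriesToFirstOrder L ψ ζ₀ ζ₁ ↔ ζ₁ = ζ₀ + twistedD₀ lam (ψ.hamiltonian hs) := by
  obtain ⟨μ, hμs, hμ, hκ⟩ := isTwist_twist L hs hint
  have hD : ∀ (y : Y) (w : leafTangent lam y), (twistedD₀ lam (ψ.hamiltonian hs)).1 y w =
      diff (ψ.hamiltonian hs) y w.1 - lam y (ψ.velocity y) * μ y w.1 := by
    intro y w
    change diff (ψ.hamiltonian hs) y w.1 - lam y (ψ.velocity y) * (twist lam).1 y w = _
    rw [hκ]
    rfl
  constructor
  · rintro ⟨g, hg, -, hg0, h⟩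
    refine Subtype.ext (funext fun y => ContinuousLinearMap.ext fun w => ?_)
    have hgy : DifferentiableAt ℝ (fun t => g t y) 0 :=
      ((hg.comp (contMDiff_id.prodMk contMDiff_const)).contDiff (𝕜 := ℝ)).differentiable
        (by simp) 0
    have h1 := (h y w.1).unique
      (hasDerivAt_carries L hs ψ ζ₀ ζ₁ hgy.hasDerivAt (hg0 y) w.1)
    have hw : lam y w.1 = 0 := w.2
    rw [extendByZero_apply_leaf L ζ₀ w.2, extendByZero_apply_leaf L ζ₁ w.2, hμ, hw] at h1
    change ζ₁.1 y w = ζ₀.1 y w + (twistedD₀ lam (ψ.hamiltonian hs)).1 y w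
    rw [hD]
    simp only [Subtype.coe_eta] at h1
    linarith
  · rintro rfl
    set ζ₁ := ζ₀ + twistedD₀ lam (ψ.hamiltonian hs) with hζ₁
    -- The extensions by zero vanish on `R` and `λ(R) = 1`, so the `R`-component forces this time
    -- derivative of `g`. The exponential below realises it without zeros and with `g_0 = 1`.
    let G : Y → ℝ := fun y =>
      diff (ψ.hamiltonian hs) y (L.field y) + extD lam y (ψ.velocity y) (L.field y)
    have hG : ContMDiff 𝓘(ℝ, E) 𝓘(ℝ, ℝ) ∞ G := by
      refine ContMDiff.add (fun y => SmoothFormAt.contMDiffAt_apply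
        (smoothFormAt_diff (ψ.hamiltonian hs) y) (L.smoothFieldAt_field hs y)) ?_
      exact ψ.contMDiff_apply_velocity fun y =>
        smoothFormAt_contractD hs (L.smoothFieldAt_field hs y)
    refine ⟨fun t y => Real.exp (t * G y), ?_, fun t y => (Real.exp_pos _).ne', fun y => by simp,
      fun y w => ?_⟩
    · exact Real.contDiff_exp.contMDiff.comp (contMDiff_fst.mul (hG.comp contMDiff_snd))
    · have hg : HasDerivAt (fun t : ℝ => Real.exp (t * G y)) (G y) 0 := by
        simpa using ((hasDerivAt_id (0 : ℝ)).mul_const (G y)).exp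
      refine (hasDerivAt_carries L hs ψ ζ₀ ζ₁ (g := fun t y => Real.exp (t * G y)) hg
        (by simp) w).congr_deriv ?_
      have key : diff (ψ.hamiltonian hs) y - contractD lam ψ.velocity y - extendByZero L ζ₁ y =
          G y • lam y - extendByZero L ζ₀ y := by
        refine covector_ext L (fun w hw => ?_) ?_
        · have h1 : extendByZero L ζ₁ y w = extendByZero L ζ₀ y w +
              (diff (ψ.hamiltonian hs) y w - lam y (ψ.velocity y) * μ y w) := by
            rw [extendByZero_apply_leaf L _ hw, extendByZero_apply_leaf L _ hw]
            exact congrArg (ζ₀.1 y ⟨w, hw⟩ + ·) (hD y ⟨w, hw⟩)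
          simp only [sub_apply, smul_apply, contractD_apply, h1, hμ, hw, smul_eq_mul]
          ring
        · simp only [sub_apply, smul_apply, contractD_apply, extendByZero_apply_field,
            L.apply_field, smul_eq_mul, extD_swap lam y (L.field y), G]
          ring
      have h2 := congrArg (fun A : Cotangent E y => A w) key
      simp only [sub_apply, smul_apply, contractD_apply, extD_swap lam y w, smul_eq_mul] at h2
      linarith

end Gauge

/-! ### Isotopies supported in a chart -/

section Construction

variable {E : Type*} [NormedAddCommGroup E] [NormedSpace ℝ E]

/-- A perturbation of the identity by a contraction is a diffeomorphism. -/
theorem exists_homeomorph_id_add [CompleteSpace E] {W : E → E} (hW : ContDiff ℝ ∞ W)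
    (hlip : ∀ x y, ‖W x - W y‖ ≤ 1 / 2 * ‖x - y‖) :
    ∃ e : E ≃ₜ E, (∀ x, e x = x + W x) ∧ ContDiff ℝ ∞ e.symm := by
  have ha : ApproximatesLinearOn (fun x => x + W x)
      ((ContinuousLinearEquiv.refl ℝ E : E ≃L[ℝ] E) : E →L[ℝ] E) Set.univ (1 / 2) := by
    intro x _ y _
    have h1 : x + W x - (y + W y) - ((ContinuousLinearEquiv.refl ℝ E : E ≃L[ℝ] E) : E →L[ℝ] E) (x - y)
        = W x - W y := by
      simp only [ContinuousLinearEquiv.coe_refl, ContinuousLinearMap.id_apply]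
      abel
    rw [h1]
    simpa using hlip x y
  -- On the zero space the identity has norm `0`, hence the separate case.
  have hc : Subsingleton E ∨ (1 / 2 : NNReal) <
      ‖(((ContinuousLinearEquiv.refl ℝ E).symm : E ≃L[ℝ] E) : E →L[ℝ] E)‖₊⁻¹ := by
    rcases subsingleton_or_nontrivial E with h | h
    · exact Or.inl h
    · right
      have : ‖(((ContinuousLinearEquiv.refl ℝ E).symm : E ≃L[ℝ] E) : E →L[ℝ] E)‖₊ = 1 := by
        simp
      rw [this, inv_one]
      exact NNReal.half_lt_self one_ne_zero
  have hnorm : ∀ x, ‖-fderiv ℝ W x‖ < 1 := by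
    intro x
    rw [norm_neg]
    have h1 : LipschitzWith (1 / 2) W := LipschitzWith.of_dist_le_mul fun a b => by
      simpa [dist_eq_norm] using hlip a b
    refine (norm_fderiv_le_of_lipschitz ℝ h1).trans_lt ?_
    norm_num
  -- The derivative `1 + DW` is invertible by the Neumann series, as `‖DW‖ ≤ 1/2`. This gives
  -- smoothness of the inverse.
  let u : E → E ≃L[ℝ] E := fun x =>
    ContinuousLinearEquiv.unitsEquiv ℝ E (Units.oneSub (-fderiv ℝ W x) (hnorm x))
  refine ⟨ha.toHomeomorph _ hc, fun x => rfl, ?_⟩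
  refine Homeomorph.contDiff_symm (f₀' := u) _ (fun x => ?_) (contDiff_id.add hW)
  have h1 : ((u x : E ≃L[ℝ] E) : E →L[ℝ] E) = ContinuousLinearMap.id ℝ E + fderiv ℝ W x := by
    ext v
    change (1 - -fderiv ℝ W x) v = _
    simp
  rw [h1]
  exact (hasFDerivAt_id x).add (hW.differentiable (by simp) x).hasFDerivAt

variable {Y : Type*} [TopologicalSpace Y] [ChartedSpace E Y]

/-- The extension by the identity of a map given in the preferred chart at `x`. -/
def chartExtend (x : Y) (F : E → E) (y : Y) : Y :=
  open Classical in
  if y ∈ (extChartAt 𝓘(ℝ, E) x).source then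
    (extChartAt 𝓘(ℝ, E) x).symm (F (extChartAt 𝓘(ℝ, E) x y)) else y

theorem chartExtend_of_mem {x y : Y} (F : E → E) (hy : y ∈ (extChartAt 𝓘(ℝ, E) x).source) :
    chartExtend x F y = (extChartAt 𝓘(ℝ, E) x).symm (F (extChartAt 𝓘(ℝ, E) x y)) := if_pos hy

theorem chartExtend_of_notMem {x y : Y} (F : E → E) (hy : y ∉ (extChartAt 𝓘(ℝ, E) x).source) :
    chartExtend x F y = y := if_neg hy

/-- An injective map which is the identity off a subset `K` of `T` preserves `T`. -/
theorem mapsTo_of_injective {K T : Set E} (hK : K ⊆ T) {F : E → E} (hF : F.Injective)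
    (hid : ∀ e ∉ K, F e = e) : Set.MapsTo F T T := by
  intro e he
  by_cases heK : e ∈ K
  · refine hK ?_
    by_contra h
    exact h (Set.mem_of_eq_of_mem (hF (hid _ h)) heK)
  · rwa [hid e heK]

theorem chartExtend_leftInverse {x : Y} {F G : E → E}
    (hF : Set.MapsTo F (extChartAt 𝓘(ℝ, E) x).target (extChartAt 𝓘(ℝ, E) x).target)
    (h : Function.LeftInverse G F) :
    Function.LeftInverse (chartExtend x G) (chartExtend x F) := by
  intro y
  by_cases hy : y ∈ (extChartAt 𝓘(ℝ, E) x).source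
  · have h1 := hF ((extChartAt 𝓘(ℝ, E) x).map_source hy)
    rw [chartExtend_of_mem F hy, chartExtend_of_mem G ((extChartAt 𝓘(ℝ, E) x).map_target h1),
      (extChartAt 𝓘(ℝ, E) x).right_inv h1, h, (extChartAt 𝓘(ℝ, E) x).left_inv hy]
  · rw [chartExtend_of_notMem F hy, chartExtend_of_notMem G hy]

variable [IsManifold 𝓘(ℝ, E) ∞ Y]

/-- The image of the compact `K` is closed because `Y` is Hausdorff, and the map is the identity off
it. At a point outside the chart this gives smoothness; inside, the chart formula does. -/
theorem contMDiff_chartExtend [T2Space Y] {x : Y} {F : ℝ → E → E} {K : Set E}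
    (hF : ContDiff ℝ ∞ (fun p : ℝ × E => F p.1 p.2)) (hK : IsCompact K)
    (hKt : K ⊆ (extChartAt 𝓘(ℝ, E) x).target) (hid : ∀ t, ∀ e ∉ K, F t e = e)
    (hmaps : ∀ t, Set.MapsTo (F t) (extChartAt 𝓘(ℝ, E) x).target (extChartAt 𝓘(ℝ, E) x).target) :
    ContMDiff (𝓘(ℝ, ℝ).prod 𝓘(ℝ, E)) 𝓘(ℝ, E) ∞ (fun p : ℝ × Y => chartExtend x (F p.1) p.2) := by
  rintro ⟨t, y⟩
  by_cases hy : y ∈ (extChartAt 𝓘(ℝ, E) x).source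
  · have h1 : ContMDiffAt (𝓘(ℝ, ℝ).prod 𝓘(ℝ, E)) 𝓘(ℝ, ℝ × E) ∞
        (fun p : ℝ × Y => (p.1, extChartAt 𝓘(ℝ, E) x p.2)) (t, y) :=
      contMDiffAt_fst.prodMk_space
        (ContMDiffAt.comp (t, y) (contMDiffAt_chart hy) contMDiffAt_snd)
    have h2 := hF.contMDiff.contMDiffAt.comp (t, y) h1
    have h3 := (contMDiffAt_chart_symm (hmaps t ((extChartAt 𝓘(ℝ, E) x).map_source hy))).comp
      (t, y) h2
    refine h3.congr_of_eventuallyEq ?_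
    filter_upwards [continuousAt_snd.preimage_mem_nhds
      ((isOpen_extChartAt_source (I := 𝓘(ℝ, E)) x).mem_nhds hy)] with p hp
    exact chartExtend_of_mem (F p.1) hp
  · have hclosed : IsClosed ((extChartAt 𝓘(ℝ, E) x).symm '' K) :=
      (hK.image_of_continuousOn ((continuousOn_extChartAt_symm x).mono hKt)).isClosed
    have hy' : y ∉ (extChartAt 𝓘(ℝ, E) x).symm '' K := by
      rintro ⟨e, he, rfl⟩
      exact hy ((extChartAt 𝓘(ℝ, E) x).map_target (hKt he))
    refine (contMDiffAt_snd (I := 𝓘(ℝ, ℝ)) (J := 𝓘(ℝ, E))).congr_of_eventuallyEq ?_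
    filter_upwards [continuousAt_snd.preimage_mem_nhds
      (hclosed.isOpen_compl.mem_nhds hy')] with p hp
    by_cases hps : p.2 ∈ (extChartAt 𝓘(ℝ, E) x).source
    · rw [chartExtend_of_mem _ hps, hid, (extChartAt 𝓘(ℝ, E) x).left_inv hps]
      exact fun h => hp ⟨_, h, (extChartAt 𝓘(ℝ, E) x).left_inv hps⟩
    · exact chartExtend_of_notMem _ hps

/-- A vector field supported in a chart is the velocity of an isotopy. -/
theorem exists_isotopy_of_chart [FiniteDimensional ℝ E] [T2Space Y] (x : Y) {W : E → E} {K : Set E}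
    (hW : ContDiff ℝ ∞ W) (hK : IsCompact K) (hKt : K ⊆ (extChartAt 𝓘(ℝ, E) x).target)
    (hWK : ∀ e ∉ K, W e = 0) :
    ∃ ψ : AmbientIsotopy E Y,
      (∀ e ∈ (extChartAt 𝓘(ℝ, E) x).target, chartField ψ.velocity x e = W e) ∧
      ∀ y ∉ (extChartAt 𝓘(ℝ, E) x).source, ψ.velocity y = 0 := by
  have := FiniteDimensional.complete ℝ E
  obtain ⟨C, hC⟩ := hW.lipschitzWith_of_hasCompactSupport (HasCompactSupport.intro hK hWK)
    (by simp)
  -- `C` is a Lipschitz constant of `W`. Using `C + 1` keeps the denominator positive, and `|β| ≤ ε`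
  -- makes `β(t) W` a contraction with constant `1/2`.
  set ε : ℝ := 1 / (2 * (C + 1)) with hε
  have hε0 : 0 < ε := by positivity
  -- A bounded reparametrization with `β(0) = 0` and `β'(0) = 1`: the family consists of
  -- diffeomorphisms for all real `t` and still has velocity `W` at zero.
  let β : ℝ → ℝ := fun t => ε * Real.sin (t / ε)
  have hβ : ContDiff ℝ ∞ β := contDiff_const.mul (Real.contDiff_sin.comp (contDiff_id.div_const ε))
  have hβ0 : β 0 = 0 := by simp [β]
  have hβ1 : HasDerivAt β 1 0 := by
    have h1 := (((hasDerivAt_id (0 : ℝ)).div_const ε).sin).const_mul ε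
    refine h1.congr_deriv ?_
    simp [hε0.ne']
  have hβle : ∀ t, |β t| * C ≤ 1 / 2 := by
    intro t
    have h1 : |β t| ≤ ε := by
      rw [abs_mul, abs_of_pos hε0]
      exact mul_le_of_le_one_right hε0.le (Real.abs_sin_le_one _)
    have h2 : ε * (C + 1) = 1 / 2 := by
      rw [hε]
      field_simp
    nlinarith [C.coe_nonneg]
  have hsm : ∀ t, ContDiff ℝ ∞ (fun e => β t • W e) := fun t => hW.const_smul (β t)
  have hlip : ∀ t, ∀ a b, ‖β t • W a - β t • W b‖ ≤ 1 / 2 * ‖a - b‖ := by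
    intro t a b
    rw [← smul_sub, norm_smul, Real.norm_eq_abs]
    have h1 : ‖W a - W b‖ ≤ C * ‖a - b‖ := by
      simpa [dist_eq_norm] using hC.dist_le_mul a b
    calc |β t| * ‖W a - W b‖ ≤ |β t| * (C * ‖a - b‖) := by gcongr
      _ = (|β t| * C) * ‖a - b‖ := by ring
      _ ≤ 1 / 2 * ‖a - b‖ := by gcongr; exact hβle t
  choose F hF hFs using fun t => exists_homeomorph_id_add (hsm t) (hlip t)
  have hFid : ∀ t, ∀ e ∉ K, F t e = e := fun t e he => by rw [hF, hWK e he, smul_zero, add_zero]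
  have hGid : ∀ t, ∀ e ∉ K, (F t).symm e = e := fun t e he => by
    rw [Homeomorph.symm_apply_eq, hFid t e he]
  have hFm := fun t => mapsTo_of_injective hKt (F t).injective (hFid t)
  have hGm := fun t => mapsTo_of_injective hKt (F t).symm.injective (hGid t)
  have hFsm : ContDiff ℝ ∞ (fun p : ℝ × E => F p.1 p.2) := by
    simp only [hF]
    exact contDiff_snd.add ((hβ.comp contDiff_fst).smul (hW.comp contDiff_snd))
  have hΨ := contMDiff_chartExtend (Y := Y) hFsm hK hKt hFid hFm
  have hslice : ∀ t : ℝ, ContMDiff 𝓘(ℝ, E) (𝓘(ℝ, ℝ).prod 𝓘(ℝ, E)) ∞ (fun y : Y => (t, y)) :=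
    fun t => contMDiff_const.prodMk contMDiff_id
  -- Joint smoothness of the inverses in `t` is not required, so the inverse at a fixed time is
  -- treated as a constant family.
  have hinv : ∀ t, ContMDiff 𝓘(ℝ, E) 𝓘(ℝ, E) ∞ (chartExtend x (F t).symm : Y → Y) := fun t =>
    (contMDiff_chartExtend (Y := Y) (F := fun _ => (F t).symm) ((hFs t).comp contDiff_snd) hK hKt
      (fun _ => hGid t) (fun _ => hGm t)).comp (hslice 0)
  let ψ : AmbientIsotopy E Y :=
    { toDiffeo := fun t =>
        { toFun := chartExtend x (F t)
          invFun := chartExtend x (F t).symm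
          left_inv := chartExtend_leftInverse (hFm t) (F t).symm_apply_apply
          right_inv := chartExtend_leftInverse (hGm t) (F t).apply_symm_apply
          contMDiff_toFun := hΨ.comp (hslice t)
          contMDiff_invFun := hinv t }
      smooth := hΨ
      map_zero := fun y => by
        change chartExtend x (F 0) y = y
        by_cases hy : y ∈ (extChartAt 𝓘(ℝ, E) x).source
        · rw [chartExtend_of_mem _ hy, hF, hβ0, zero_smul, add_zero,
            (extChartAt 𝓘(ℝ, E) x).left_inv hy]
        · exact chartExtend_of_notMem _ hy }
  have hψ : ∀ t y, ψ.toDiffeo t y = chartExtend x (F t) y := fun t y => rfl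
  refine ⟨ψ, fun e he => ?_, fun y hy => ?_⟩
  · rw [ψ.chartField_velocity x he]
    have hl : HasDerivAt (fun t : ℝ => (t, e)) ((1 : ℝ), (0 : E)) 0 :=
      (hasDerivAt_id (0 : ℝ)).prodMk (hasDerivAt_const 0 e)
    have hd : HasFDerivAt (ψ.inChart x) (fderiv ℝ (ψ.inChart x) (0, e)) (0, e) :=
      ((ψ.contDiffAt_inChart x he).differentiableAt (by simp)).hasFDerivAt
    have h1 := HasFDerivAt.comp_hasDerivAt (f := fun t : ℝ => (t, e)) 0 hd hl
    have h2 : (ψ.inChart x ∘ fun t : ℝ => (t, e)) = fun t => e + β t • W e := by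
      funext t
      have h3 := (extChartAt 𝓘(ℝ, E) x).map_target he
      simp only [Function.comp, AmbientIsotopy.inChart, hψ]
      rw [chartExtend_of_mem _ h3, (extChartAt 𝓘(ℝ, E) x).right_inv he,
        (extChartAt 𝓘(ℝ, E) x).right_inv (hFm t he), hF]
    rw [h2] at h1
    have h4 : HasDerivAt (fun t => e + β t • W e) (W e) 0 := by
      simpa using (hβ1.smul_const (W e)).const_add e
    exact h1.unique h4
  · have h1 : (fun t : ℝ => ψ.toDiffeo t y) = fun _ => y := by
      funext t
      rw [hψ, chartExtend_of_notMem _ hy]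
    unfold AmbientIsotopy.velocity
    rw [h1, mfderiv_const]
    rfl

end Construction

/-! ### Every function is a Hamiltonian -/

section Hamiltonians

variable {E : Type*} [NormedAddCommGroup E] [NormedSpace ℝ E]
  {Y : Type*} [TopologicalSpace Y] [ChartedSpace E Y] [IsManifold 𝓘(ℝ, E) ∞ Y]

namespace AmbientIsotopy

/-- The constant isotopy. -/
def refl : AmbientIsotopy E Y where
  toDiffeo _ := Diffeomorph.refl _ _ _
  smooth := contMDiff_snd
  map_zero _ := rfl

/-- The composition of two isotopies. -/
def comp (ψ χ : AmbientIsotopy E Y) : AmbientIsotopy E Y where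
  toDiffeo t := (χ.toDiffeo t).trans (ψ.toDiffeo t)
  smooth := ψ.smooth.comp (contMDiff_fst.prodMk χ.smooth)
  map_zero y := by
    change ψ.toDiffeo 0 (χ.toDiffeo 0 y) = y
    rw [χ.map_zero, ψ.map_zero]

theorem velocity_refl (y : Y) : (refl : AmbientIsotopy E Y).velocity y = 0 := by
  have h1 : (fun t : ℝ => (refl : AmbientIsotopy E Y).toDiffeo t y) = fun _ => y := rfl
  unfold AmbientIsotopy.velocity
  rw [h1, mfderiv_const]
  rfl

/-- At time zero the spatial derivative of `ψ` is the identity, so by the chain rule velocities add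
under composition. -/
theorem chartField_velocity_comp (ψ χ : AmbientIsotopy E Y) (y : Y) :
    chartField (ψ.comp χ).velocity y (extChartAt 𝓘(ℝ, E) y y) =
      chartField ψ.velocity y (extChartAt 𝓘(ℝ, E) y y) +
        chartField χ.velocity y (extChartAt 𝓘(ℝ, E) y y) := by
  have hy := mem_extChartAt_target (I := 𝓘(ℝ, E)) y
  rw [chartField_velocity _ y hy, chartField_velocity _ y hy, chartField_velocity _ y hy]
  set e := extChartAt 𝓘(ℝ, E) y y with he
  have hd : ∀ ψ : AmbientIsotopy E Y, HasFDerivAt (ψ.inChart y) (fderiv ℝ (ψ.inChart y) (0, e))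
      (0, e) := fun ψ => ((ψ.contDiffAt_inChart y hy).differentiableAt (by simp)).hasFDerivAt
  have hl : HasDerivAt (fun t : ℝ => (t, e)) ((1 : ℝ), (0 : E)) 0 :=
    (hasDerivAt_id (0 : ℝ)).prodMk (hasDerivAt_const 0 e)
  have h1 : ∀ ψ : AmbientIsotopy E Y, HasDerivAt (fun t : ℝ => ψ.inChart y (t, e))
      (fderiv ℝ (ψ.inChart y) (0, e) (1, 0)) 0 := fun ψ =>
    HasFDerivAt.comp_hasDerivAt (f := fun t : ℝ => (t, e)) 0 (hd ψ) hl
  have h2 : HasDerivAt (fun t : ℝ => (t, χ.inChart y (t, e)))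
      ((1 : ℝ), fderiv ℝ (χ.inChart y) (0, e) (1, 0)) 0 := (hasDerivAt_id (0 : ℝ)).prodMk (h1 χ)
  have h3 : HasDerivAt (fun t : ℝ => ψ.inChart y (t, χ.inChart y (t, e)))
      (fderiv ℝ (ψ.inChart y) (0, e) (1, fderiv ℝ (χ.inChart y) (0, e) (1, 0))) 0 := by
    have hd' : HasFDerivAt (ψ.inChart y) (fderiv ℝ (ψ.inChart y) (0, e))
        (0, χ.inChart y (0, e)) := by
      rw [χ.inChart_zero y hy]
      exact hd ψ
    exact HasFDerivAt.comp_hasDerivAt (f := fun t : ℝ => (t, χ.inChart y (t, e))) 0 hd' h2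
  have h4 : (fun t : ℝ => (ψ.comp χ).inChart y (t, e)) =ᶠ[𝓝 0]
      fun t => ψ.inChart y (t, χ.inChart y (t, e)) := by
    have h5 : ∀ᶠ t : ℝ in 𝓝 0, χ.toDiffeo t y ∈ (extChartAt 𝓘(ℝ, E) y).source := by
      refine (χ.contMDiff_orbit y).continuous.continuousAt.eventually_mem ?_
      rw [χ.map_zero]
      exact extChartAt_source_mem_nhds y
    filter_upwards [h5] with t ht
    simp only [inChart, he, extChartAt_to_inv, (extChartAt 𝓘(ℝ, E) y).left_inv ht]
    rfl
  have h6 := (h1 (ψ.comp χ)).unique (h3.congr_of_eventuallyEq h4)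
  have h7 : ((1 : ℝ), fderiv ℝ (χ.inChart y) (0, e) (1, 0)) =
      (1, 0) + (0, fderiv ℝ (χ.inChart y) (0, e) (1, 0)) := by simp
  have h8 : ∀ v : E, fderiv ℝ (ψ.inChart y) (0, e) (0, v) = v := by
    intro v
    have h9 : HasFDerivAt (fun z => ψ.inChart y (0, z))
        ((fderiv ℝ (ψ.inChart y) (0, e)).comp (ContinuousLinearMap.inr ℝ ℝ E)) e :=
      (hd ψ).comp e (hasFDerivAt_prodMk_right 0 e)
    have h10 := h9.unique ((hasFDerivAt_id e).congr_of_eventuallyEq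
      (Filter.eventually_of_mem (extChartAt_target_mem_nhds y) fun z hz => ψ.inChart_zero y hz))
    exact congrArg (fun T : E →L[ℝ] E => T v) h10
  rw [h6, h7, map_add, h8]

theorem apply_velocity_comp (ψ χ : AmbientIsotopy E Y) (θ : CovectorField E Y) (y : Y) :
    θ y ((ψ.comp χ).velocity y) = θ y (ψ.velocity y) + θ y (χ.velocity y) := by
  simp only [← chartForm_apply_self θ, ← chartField_self, chartField_velocity_comp, map_add]

end AmbientIsotopy

variable [FiniteDimensional ℝ E] [T2Space Y] [CompactSpace Y] {lam : CovectorField E Y}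

/-- A function supported where a constant field of a chart is transverse to the foliation is the
Hamiltonian of an ambient isotopy. -/
theorem exists_isotopy_of_tsupport_subset (hs : IsOneForm lam) (x : Y) (w : E) {q : Y → ℝ}
    (hq : ContMDiff 𝓘(ℝ, E) 𝓘(ℝ, ℝ) ∞ q) {U : Set Y}
    (hUs : U ⊆ (extChartAt 𝓘(ℝ, E) x).source)
    (hUw : ∀ y ∈ U, chartForm lam x (extChartAt 𝓘(ℝ, E) x y) w ≠ 0) (hqU : tsupport q ⊆ U) :
    ∃ ψ : AmbientIsotopy E Y, ∀ y, lam y (ψ.velocity y) = q y := by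
  classical
  set φ := extChartAt 𝓘(ℝ, E) x with hφ
  let K : Set E := φ '' tsupport q
  -- The multiple of the constant field `w` on which `λ` takes the value `q`. It need not point
  -- along `L`, as only `λ(V)` is prescribed.
  let W : E → E := fun e =>
    if e ∈ φ.target then (q (φ.symm e) / chartForm lam x e w) • w else 0
  have hK : IsCompact K := ((isClosed_tsupport q).isCompact).image_of_continuousOn
    ((continuousOn_extChartAt x).mono (hqU.trans hUs))
  have hKt : K ⊆ φ.target := by
    rintro _ ⟨y, hy, rfl⟩
    exact φ.map_source (hUs (hqU hy))
  have hWK : ∀ e ∉ K, W e = 0 := by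
    intro e he
    by_cases het : e ∈ φ.target
    · have h1 : q (φ.symm e) = 0 := image_eq_zero_of_notMem_tsupport fun h =>
        he ⟨_, h, φ.right_inv het⟩
      simp only [W, if_pos het, h1, zero_div, zero_smul]
    · exact if_neg het
  have hW : ContDiff ℝ ∞ W := by
    rw [contDiff_iff_contDiffAt]
    intro e
    by_cases he : e ∈ K
    · have het := hKt he
      obtain ⟨y, hy, hye⟩ := he
      have hne : chartForm lam x e w ≠ 0 := hye ▸ hUw y (hqU hy)
      have h1 : ContDiffAt ℝ ∞ (fun e => q (φ.symm e)) e :=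
        (hq.contMDiffAt.comp e (contMDiffAt_chart_symm het)).contDiffAt
      have h2 : ContDiffAt ℝ ∞ (fun e => chartForm lam x e w) e :=
        (SmoothFormAt.contDiffAt_chartForm het (hs _)).clm_apply contDiffAt_const
      refine ((h1.div h2 hne).smul (contDiffAt_const (c := w))).congr_of_eventuallyEq ?_
      filter_upwards [(isOpen_extChartAt_target (I := 𝓘(ℝ, E)) x).mem_nhds het] with z hz
      exact if_pos hz
    · refine (contDiffAt_const (c := (0 : E))).congr_of_eventuallyEq ?_
      filter_upwards [hK.isClosed.isOpen_compl.mem_nhds he] with z hz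
      exact hWK z hz
  obtain ⟨ψ, hψ, hψ'⟩ := exists_isotopy_of_chart x hW hK hKt hWK
  refine ⟨ψ, fun y => ?_⟩
  by_cases hy : y ∈ φ.source
  · have ht := φ.map_source hy
    have h1 := chartForm_chartField lam ψ.velocity ht
    rw [hψ _ ht, φ.left_inv hy] at h1
    rw [← h1]
    simp only [W, if_pos ht, φ.left_inv hy, map_smul, smul_eq_mul]
    by_cases hyU : y ∈ U
    · exact div_mul_cancel₀ _ (hUw y hyU)
    · rw [image_eq_zero_of_notMem_tsupport fun h => hyU (hqU h), zero_div, zero_mul]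
  · rw [hψ' y hy, map_zero, image_eq_zero_of_notMem_tsupport fun h => hy (hUs (hqU h))]

/-- Near each point some constant field of the chart is transverse to `ker λ`. A subordinate
partition of unity cuts `f` into pieces realised in single charts, and composing the isotopies adds
the pieces. -/
theorem exists_isotopy_apply_velocity_eq (hs : IsOneForm lam) (hne : ∀ y, lam y ≠ 0) {f : Y → ℝ}
    (hf : ContMDiff 𝓘(ℝ, E) 𝓘(ℝ, ℝ) ∞ f) :
    ∃ ψ : AmbientIsotopy E Y, ∀ y, lam y (ψ.velocity y) = f y := by
  have hloc : ∀ x : Y, ∃ w : E, ∃ U : Set Y, IsOpen U ∧ x ∈ U ∧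
      U ⊆ (extChartAt 𝓘(ℝ, E) x).source ∧
      ∀ y ∈ U, chartForm lam x (extChartAt 𝓘(ℝ, E) x y) w ≠ 0 := by
    intro x
    obtain ⟨v, hv⟩ : ∃ v, lam x v ≠ 0 := by
      by_contra! h
      exact hne x (ContinuousLinearMap.ext h)
    have h1 : ContinuousAt (fun y => chartForm lam x (extChartAt 𝓘(ℝ, E) x y) (chartMap x x v)) x :=
      ContinuousAt.comp (g := fun e => chartForm lam x e (chartMap x x v))
        ((SmoothFormAt.contDiffAt_chartForm_self (hs x)).clm_apply contDiffAt_const).continuousAt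
        (continuousAt_extChartAt x)
    have h2 : ∀ᶠ y in 𝓝 x, chartForm lam x (extChartAt 𝓘(ℝ, E) x y) (chartMap x x v) ≠ 0 :=
      h1.eventually_ne (by rwa [chartForm_apply_self])
    obtain ⟨U, hU, hUo, hxU⟩ := mem_nhds_iff.1
      (Filter.inter_mem h2 (extChartAt_source_mem_nhds (I := 𝓘(ℝ, E)) x))
    exact ⟨_, U, hUo, hxU, fun y hy => (hU hy).2, fun y hy => (hU hy).1⟩
  choose w U hUo hxU hUs hUw using hloc
  obtain ⟨ρ, hρ⟩ := SmoothPartitionOfUnity.exists_isSubordinate 𝓘(ℝ, E) isClosed_univ U hUo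
    (fun x _ => Set.mem_iUnion.2 ⟨x, hxU x⟩)
  -- Compactness of `Y` makes the partition finite, so finitely many compositions suffice.
  have hfin : {i | (Function.support (ρ i)).Nonempty}.Finite :=
    ρ.locallyFinite.finite_nonempty_of_compact
  have hsum : ∀ S : Finset Y, ∃ ψ : AmbientIsotopy E Y,
      ∀ y, lam y (ψ.velocity y) = ∑ i ∈ S, ρ i y * f y := by
    intro S
    classical
    induction S using Finset.induction_on with
    | empty => exact ⟨AmbientIsotopy.refl, fun y => by
        rw [AmbientIsotopy.velocity_refl, map_zero, Finset.sum_empty]⟩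
    | insert i S hi ih =>
      obtain ⟨χ, hχ⟩ := ih
      obtain ⟨ψ, hψ⟩ := exists_isotopy_of_tsupport_subset hs i (w i)
        (q := fun y => ρ i y * f y) ((ρ i).contMDiff.mul hf) (hUs i) (hUw i)
        ((tsupport_mul_subset_left).trans (hρ i))
      refine ⟨ψ.comp χ, fun y => ?_⟩
      rw [AmbientIsotopy.apply_velocity_comp, hψ, hχ, Finset.sum_insert hi]
  obtain ⟨ψ, hψ⟩ := hsum hfin.toFinset
  refine ⟨ψ, fun y => ?_⟩
  rw [hψ, ← Finset.sum_mul]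
  have h1 : ∑ i ∈ hfin.toFinset, ρ i y = 1 := by
    rw [← ρ.sum_eq_one (Set.mem_univ y), finsum_eq_sum_of_support_subset]
    intro i hi
    simp only [Set.Finite.coe_toFinset, Set.mem_ofPred_eq]
    exact ⟨y, hi⟩
  rw [h1, one_mul]

end Hamiltonians

/-! ### Coisotropic submanifolds of the least dimension -/

section Coisotropic

/-- In a hyperplane `ker a` with nondegenerate skew form `B`, a coisotropic subspace of half the
dimension is isotropic. -/
theorem isotropic_of_coisotropic {V W : Type*} [AddCommGroup V] [Module ℝ V] [AddCommGroup W]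
    [Module ℝ W] [FiniteDimensional ℝ V] [FiniteDimensional ℝ W] {n : ℕ}
    (hV : Module.finrank ℝ V = 2 * n + 1) (hW : Module.finrank ℝ W = n + 1)
    (a : V →ₗ[ℝ] ℝ) (B : LinearMap.BilinForm ℝ V) (hB : ∀ u v, B u v = -B v u)
    (hnd : ∀ u, a u = 0 → (∀ w, a w = 0 → B u w = 0) → u = 0)
    (J : W →ₗ[ℝ] V) (hJ : Function.Injective J) (haJ : a ∘ₗ J ≠ 0)
    (hco : ∀ u, a u = 0 → (∀ w, a (J w) = 0 → B u (J w) = 0) → ∃ w, J w = u)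
    {u v : W} (hu : a (J u) = 0) (hv : a (J v) = 0) : B (J u) (J v) = 0 := by
  have ha : a ≠ 0 := fun h => haJ (by rw [h, LinearMap.zero_comp])
  have h1 := Module.Dual.finrank_ker_add_one_of_ne_zero ha
  have h2 := Module.Dual.finrank_ker_add_one_of_ne_zero haJ
  let J' : LinearMap.ker (a ∘ₗ J) →ₗ[ℝ] LinearMap.ker a :=
    (J ∘ₗ (LinearMap.ker (a ∘ₗ J)).subtype).codRestrict _ fun w => w.2
  have hJ' : Function.Injective J' := fun x y h =>
    Subtype.ext (hJ (congrArg Subtype.val h))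
  let B' : LinearMap.BilinForm ℝ (LinearMap.ker a) := B.restrict (LinearMap.ker a)
  have hB' : B'.IsRefl := fun x y h => by
    change B y x = 0
    rw [hB, show B x y = 0 from h, neg_zero]
  have hnd' : B'.Nondegenerate := by
    refine (LinearMap.IsRefl.nondegenerate_iff_separatingLeft hB').2 fun x hx => ?_
    exact Subtype.ext (hnd x x.2 fun w hw => hx ⟨w, hw⟩)
  have h3 : Module.finrank ℝ (LinearMap.range J') = n := by
    rw [LinearMap.finrank_range_of_inj hJ']
    omega
  have h4 := LinearMap.BilinForm.finrank_orthogonal hnd' (LinearMap.range J')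
  have h5 : B'.orthogonal (LinearMap.range J') ≤ LinearMap.range J' := by
    intro x hx
    obtain ⟨w, hw⟩ := hco x x.2 fun w hw => by
      rw [hB]
      exact neg_eq_zero.2 (hx _ ⟨⟨w, hw⟩, rfl⟩)
    exact ⟨⟨w, by rw [LinearMap.mem_ker, LinearMap.comp_apply, hw]; exact x.2⟩, Subtype.ext hw⟩
  -- `ker a` has dimension `2n` and the range dimension `n`, so its orthogonal also has dimension
  -- `n`; coisotropy then forces equality.
  have h6 := Submodule.eq_of_le_of_finrank_eq h5 (by omega)
  have h7 : J' ⟨v, hv⟩ ∈ B'.orthogonal (LinearMap.range J') := by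
    rw [h6]
    exact ⟨_, rfl⟩
  exact h7 _ ⟨⟨u, hu⟩, rfl⟩

variable {E : Type*} [NormedAddCommGroup E] [NormedSpace ℝ E] [FiniteDimensional ℝ E]
  {M : Type*} [TopologicalSpace M] [ChartedSpace E M] [IsManifold 𝓘(ℝ, E) ∞ M]
  {E' : Type*} [NormedAddCommGroup E'] [NormedSpace ℝ E'] [FiniteDimensional ℝ E']
  {Y : Type*} [TopologicalSpace Y] [ChartedSpace E' Y] [IsManifold 𝓘(ℝ, E') ∞ Y]

/-- The exterior derivative at a point, as a bilinear form. -/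
def extDBilin (θ : CovectorField E M) (x : M) : LinearMap.BilinForm ℝ E :=
  let D := fderiv ℝ (chartForm θ x) (extChartAt 𝓘(ℝ, E) x x)
  let B : LinearMap.BilinForm ℝ E := LinearMap.mk₂ ℝ (fun u v => D u v - D v u)
    (fun u u' v => by simp only [map_add, add_apply]; ring)
    (fun c u v => by simp only [map_smul, smul_apply, smul_eq_mul]; ring)
    (fun u v v' => by simp only [map_add, add_apply]; ring)
    (fun c u v => by simp only [map_smul, smul_apply, smul_eq_mul]; ring)
  B.comp (mfderiv 𝓘(ℝ, E) 𝓘(ℝ, E) (extChartAt 𝓘(ℝ, E) x) x).toLinearMap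
    (mfderiv 𝓘(ℝ, E) 𝓘(ℝ, E) (extChartAt 𝓘(ℝ, E) x) x).toLinearMap

/-- By naturality `dλ` is the restriction of `dα`, and `TY ∩ ξ` is Lagrangian in `ξ` by the
dimension count. This is the integrability of `ker λ`. -/
theorem IsCoisotropic.extD_pullbackForm_eq_zero {n : ℕ} (hE : Module.finrank ℝ E = 2 * n + 1)
    (hE' : Module.finrank ℝ E' = n + 1) {α : CovectorField E M} (hα : IsContactForm α)
    {j : Y → M} (hj : IsEmbeddedSubmanifold (E := E) (E' := E') j)
    (hco : IsCoisotropic (E' := E') α j)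
    (hne : ∀ y, (pullbackForm j α : CovectorField E' Y) y ≠ 0) (y : Y)
    (u v : TangentSpace 𝓘(ℝ, E') y) (hu : (pullbackForm j α : CovectorField E' Y) y u = 0)
    (hv : (pullbackForm j α : CovectorField E' Y) y v = 0) :
    extD (pullbackForm j α : CovectorField E' Y) y u v = 0 := by
  rw [extD_pullbackForm (hj.smooth y) (hα.smooth _)]
  refine isotropic_of_coisotropic hE hE' (α (j y)).toLinearMap (extDBilin α (j y))
    (fun u v => extD_swap α (j y) u v) (fun u => hα.nondegenerate (j y) u)
    (mfderiv 𝓘(ℝ, E') 𝓘(ℝ, E) j y).toLinearMap (hj.injective_mfderiv y)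
    (fun h => hne y (ContinuousLinearMap.ext fun w => LinearMap.congr_fun h w))
    (fun u => hco y u) hu hv

end Coisotropic

/-! ### Classification up to gauge equivalence -/

section Gauge

variable {E : Type*} [NormedAddCommGroup E] [NormedSpace ℝ E] [FiniteDimensional ℝ E]
  {Y : Type*} [TopologicalSpace Y] [T2Space Y] [CompactSpace Y] [ChartedSpace E Y]
  [IsManifold 𝓘(ℝ, E) ∞ Y] {lam : CovectorField E Y}

theorem exists_hamiltonian_eq (hs : IsOneForm lam) (hne : ∀ y, lam y ≠ 0)
    (f : C^∞⟮𝓘(ℝ, E), Y; ℝ⟯) : ∃ ψ : AmbientIsotopy E Y, ψ.hamiltonian hs = f := by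
  obtain ⟨ψ, h⟩ := exists_isotopy_apply_velocity_eq hs hne f.contMDiff
  exact ⟨ψ, ContMDiffMap.ext h⟩

theorem isInducedBy_iff (L : TransverseLineField lam) (hs : IsOneForm lam)
    (hint : ∀ y u v, lam y u = 0 → lam y v = 0 → extD lam y u v = 0) (ψ : AmbientIsotopy E Y)
    (ζ : TangentialForm lam) :
    IsInducedBy L ψ ζ ↔ ζ = twistedD₀ lam (ψ.hamiltonian hs) := by
  rw [IsInducedBy, carriesToFirstOrder_iff L hs hint, zero_add]

/-- An isotopy shifts by the twisted differential of its Hamiltonian, and every function is a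
Hamiltonian. So the gauge classes are the cosets of the coboundaries, whence also the equivalence
relation. -/
theorem gaugeEquivalent_iff (L : TransverseLineField lam) (hs : IsOneForm lam)
    (hne : ∀ y, lam y ≠ 0)
    (hint : ∀ y u v, lam y u = 0 → lam y v = 0 → extD lam y u v = 0)
    (ζ₀ ζ₁ : {ζ : TangentialForm lam // IsInfinitesimalDeformation L ζ}) :
    GaugeEquivalent L ζ₀ ζ₁ ↔ ζ₁.1 - ζ₀.1 ∈ twistedCoboundaries lam := by
  simp only [GaugeEquivalent, carriesToFirstOrder_iff L hs hint]
  constructor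
  · rintro ⟨ψ, h⟩
    exact ⟨_, (sub_eq_of_eq_add' h).symm⟩
  · rintro ⟨f, hf⟩
    obtain ⟨ψ, hψ⟩ := exists_hamiltonian_eq hs hne f
    exact ⟨ψ, by rw [hψ, hf, add_sub_cancel]⟩

theorem equivalence_gaugeEquivalent (L : TransverseLineField lam) (hs : IsOneForm lam)
    (hne : ∀ y, lam y ≠ 0)
    (hint : ∀ y u v, lam y u = 0 → lam y v = 0 → extD lam y u v = 0) :
    Equivalence (GaugeEquivalent L) where
  refl ζ := by
    rw [gaugeEquivalent_iff L hs hne hint, sub_self]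
    exact zero_mem _
  symm := by
    intro ζ η h
    rw [gaugeEquivalent_iff L hs hne hint] at h ⊢
    rw [← neg_sub]
    exact neg_mem h
  trans := by
    intro ζ η θ h h'
    rw [gaugeEquivalent_iff L hs hne hint] at h h' ⊢
    rw [← sub_add_sub_cancel]
    exact add_mem h' h

/-- Infinitesimal deformations modulo gauge equivalence are classified by the first twisted
cohomology. -/
theorem exists_equiv_twistedH1 (L : TransverseLineField lam) (hs : IsOneForm lam)
    (hne : ∀ y, lam y ≠ 0)
    (hint : ∀ y u v, lam y u = 0 → lam y v = 0 → extD lam y u v = 0) :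
    ∃ Φ : Quot (GaugeEquivalent L) ≃ TwistedH1 lam,
      ∀ ζ : {ζ : TangentialForm lam // IsInfinitesimalDeformation L ζ},
        ∃ h : ζ.1 ∈ twistedCocycles lam,
          Φ (Quot.mk _ ζ) = Submodule.Quotient.mk ⟨ζ.1, h⟩ := by
  have hmem : ∀ ζ : {ζ : TangentialForm lam // IsInfinitesimalDeformation L ζ},
      ζ.1 ∈ twistedCocycles lam := fun ζ =>
    LinearMap.mem_ker.2 ((isInfinitesimalDeformation_iff L hs hint ζ.1).1 ζ.2)
  have hiff : ∀ ζ η : {ζ : TangentialForm lam // IsInfinitesimalDeformation L ζ},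
      (Submodule.Quotient.mk ⟨ζ.1, hmem ζ⟩ : TwistedH1 lam) =
        Submodule.Quotient.mk ⟨η.1, hmem η⟩ ↔ GaugeEquivalent L ζ η := fun ζ η => by
    rw [gaugeEquivalent_iff L hs hne hint, eq_comm, Submodule.Quotient.eq]
    rfl
  let F : Quot (GaugeEquivalent L) → TwistedH1 lam :=
    Quot.lift (fun ζ => Submodule.Quotient.mk ⟨ζ.1, hmem ζ⟩) fun ζ η h => (hiff ζ η).2 h
  refine ⟨Equiv.ofBijective F ⟨?_, ?_⟩, fun ζ => ⟨hmem ζ, rfl⟩⟩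
  · rintro ⟨ζ⟩ ⟨η⟩ h
    exact Quot.sound ((hiff ζ η).1 h)
  · intro c
    obtain ⟨ζ, rfl⟩ := Submodule.Quotient.mk_surjective _ c
    exact ⟨Quot.mk _ ⟨ζ.1, (isInfinitesimalDeformation_iff L hs hint ζ.1).2
      (LinearMap.mem_ker.1 ζ.2)⟩, rfl⟩

end Gauge

end LegendrianFoliation

end

/-! ### The main theorem. -/

theorem mainTheorem3 (n : ℕ)
    {M : Type*} [TopologicalSpace M] [T2Space M]
    [ChartedSpace (EuclideanSpace ℝ (Fin (2 * n + 1))) M]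
    [IsManifold 𝓘(ℝ, EuclideanSpace ℝ (Fin (2 * n + 1))) ∞ M]
    {Y : Type*} [TopologicalSpace Y] [T2Space Y] [CompactSpace Y]
    [ChartedSpace (EuclideanSpace ℝ (Fin (n + 1))) Y]
    [IsManifold 𝓘(ℝ, EuclideanSpace ℝ (Fin (n + 1))) ∞ Y]
    (α : LegendrianFoliation.CovectorField (EuclideanSpace ℝ (Fin (2 * n + 1))) M)
    (hα : LegendrianFoliation.IsContactForm α)
    (j : Y → M) (hj : LegendrianFoliation.IsEmbeddedSubmanifold
      (E := EuclideanSpace ℝ (Fin (2 * n + 1))) (E' := EuclideanSpace ℝ (Fin (n + 1))) j)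
    (hcoiso : LegendrianFoliation.IsCoisotropic
      (E' := EuclideanSpace ℝ (Fin (n + 1))) α j)
    (lam : LegendrianFoliation.CovectorField (EuclideanSpace ℝ (Fin (n + 1))) Y)
    (hlam : lam = LegendrianFoliation.pullbackForm j α)
    (hnonsing : ∀ y, lam y ≠ 0)
    (L : LegendrianFoliation.TransverseLineField lam) :
    -- infinitesimal deformations are the twisted cocycles
    (∀ ζ : LegendrianFoliation.TangentialForm lam,
      LegendrianFoliation.IsInfinitesimalDeformation L ζ ↔
        LegendrianFoliation.twistedD₁ lam ζ = 0) ∧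
    -- coboundaries are cocycles
    (∀ f, LegendrianFoliation.twistedD₁ lam (LegendrianFoliation.twistedD₀ lam f) = 0) ∧
    -- every ambient isotopy induces a unique tangential one-form, and the forms so
    -- obtained are exactly the coboundaries
    (∀ ψ, ∃! ζ : LegendrianFoliation.TangentialForm lam,
      LegendrianFoliation.IsInducedBy L ψ ζ) ∧
    (∀ ζ : LegendrianFoliation.TangentialForm lam,
      (∃ ψ, LegendrianFoliation.IsInducedBy L ψ ζ) ↔
        ∃ f, ζ = LegendrianFoliation.twistedD₀ lam f) ∧
    -- infinitesimal deformations modulo gauge equivalence are the first twisted cohomology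
    Equivalence (LegendrianFoliation.GaugeEquivalent L) ∧
    ∃ Φ : Quot (LegendrianFoliation.GaugeEquivalent L) ≃ LegendrianFoliation.TwistedH1 lam,
      ∀ ζ : {ζ : LegendrianFoliation.TangentialForm lam //
          LegendrianFoliation.IsInfinitesimalDeformation L ζ},
        ∃ h : ζ.1 ∈ LegendrianFoliation.twistedCocycles lam,
          Φ (Quot.mk _ ζ) = Submodule.Quotient.mk ⟨ζ.1, h⟩ := by
  subst hlam
  have hs : LegendrianFoliation.IsOneForm (LegendrianFoliation.pullbackForm j α :
      LegendrianFoliation.CovectorField (EuclideanSpace ℝ (Fin (n + 1))) Y) := fun y =>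
    LegendrianFoliation.SmoothFormAt.pullbackForm (hj.smooth y) (hα.smooth _)
  -- From here on the contact manifold plays no role: smoothness, integrability and nonvanishing of
  -- `λ` are all that the rest needs.
  have hint := LegendrianFoliation.IsCoisotropic.extD_pullbackForm_eq_zero (n := n) (by simp)
    (by simp) hα hj hcoiso hnonsing
  refine ⟨LegendrianFoliation.isInfinitesimalDeformation_iff L hs hint,
    LegendrianFoliation.twistedD₁_twistedD₀ L hs hint, fun ψ => ?_, fun ζ => ?_,
    LegendrianFoliation.equivalence_gaugeEquivalent L hs hnonsing hint,
    LegendrianFoliation.exists_equiv_twistedH1 L hs hnonsing hint⟩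
  · exact ⟨_, (LegendrianFoliation.isInducedBy_iff L hs hint ψ _).2 rfl,
      fun ζ => (LegendrianFoliation.isInducedBy_iff L hs hint ψ ζ).1⟩
  · constructor
    · rintro ⟨ψ, h⟩
      exact ⟨_, (LegendrianFoliation.isInducedBy_iff L hs hint ψ ζ).1 h⟩
    · rintro ⟨f, rfl⟩
      obtain ⟨ψ, hψ⟩ := LegendrianFoliation.exists_hamiltonian_eq hs hnonsing f
      exact ⟨ψ, (LegendrianFoliation.isInducedBy_iff L hs hint ψ _).2 (by rw [hψ])⟩
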